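/- Let $K$ be a global field (a number field, or a function field in one variable over a finite field $k$). Let $M_K$ be its set of places, with absolute values $|\cdot|_v$, completions $K_v$ and local degrees $n_v$, normalized as follows. If $K$ is a number field, $M_K$ consists of the absolute values that restrict to the usual real absolute value or to a usual $p$-adic absolute value on $\mathbb{Q}$, and $n_v=[K_v:\mathbb{Q}_v]$. If $K$ is a function field over $k$, $M_K$ is the set of normalized (surjective onto $\mathbb{Z}\cup\{\infty\}$) discrete valuations $\mathrm{ord}_v$ of $K$ that are trivial on $k$, $|x|_v=e^{-\mathrm{ord}_v(x)}$, and $n_v$ is the degree over $k$ of the residue field of $v$. Put $\|(x,y)\|_v=\max\{|x|_v,|y|_v\}$ and, for $P=[x,y]\in\mathbb{P}^1(K)$, $h(P)=\sum_{v\in M_K}n_v\log\|(x,y)\|_v$. Let $S$ be a finite set of endomorphisms of $\mathbb{P}^1$ over $K$, all of degree at least $2$, and for each $\phi\in S$ fix any lift $\tilde\phi:\mathbb{A}^2\to\mathbb{A}^2$ over $K$, that is, a pair of homogeneous polynomials of degree $\deg\phi$ over $K$ without common zero in $\mathbb{A}^2(\overline K)\smallsetminus\{(0,0)\}$ that induces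 $\phi$. For a sequence $\gamma=(\theta_n)_{n\ge1}$ in $S$ put $\gamma_n=\theta_n\circ\dots\circ\theta_1$, $\tilde\gamma_n=\tilde\theta_n\circ\dots\circ\tilde\theta_1$ and $\deg\gamma_n=\deg\tilde\gamma_n=\prod_{i\le n}\deg\theta_i$. Then for every such $\gamma$, every $v\in M_K$ and every $(x,y)\in K_v^2\smallsetminus\{(0,0)\}$, the limit $$\mathcal{G}_{v,\tilde\gamma}(x,y)=\lim_{n\to\infty}\frac{\log\|\tilde\gamma_n(x,y)\|_v}{\deg\tilde\gamma_n}$$ exists, and: (1) There are constants $C_v$ $(v\in M_K)$, depending only on $v$ and on the fixed lifts of the elements of $S$ (not on $\gamma$ or $(x,y)$) and equal to $0$ for all but finitely many $v$, such that $\big|\mathcal{G}_{v,\tilde\gamma}(x,y)-\log\|(x,y)\|_v\big|\le C_v$ for all $\gamma$, all $v\in M_K$ and all $(x,y)\in K_v^2\smallsetminus\{(0,0)\}$. (2) For every $\gamma$ and every $P=[x,y]\in\mathbb{P}^1(K)$ with representative $(x,y)\in K^2\smallsetminus\{(0,0)\}$, the canonical height $\hat h_\gamma(P)=\lim_{n\to\infty}h(\gamma_n\cdot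 P)/\deg\gamma_n$ exists, only finitely many of the terms $n_v\,\mathcal{G}_{v,\tilde\gamma}(x,y)$ are nonzero, and $$\hat h_\gamma(P)=\sum_{v\in M_K}n_v\,\mathcal{G}_{v,\tilde\gamma}(x,y).$$ -/

import Mathlib

open Filter Topology
open scoped WithZero NNReal LinearAlgebra.Projectivization

noncomputable section

namespace RandomDynamics

universe u

/-! ### Global fields, their places, absolute values and local degrees -/

/-- The places of a number field `K`: the absolute values of `K` whose restriction to `ℚ` is the
usual real absolute value or one of the usual `p`-adic absolute values. -/
def NumberFieldPlace (K : Type u) [Field K] [CharZero K] : Type u :=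
  {v : AbsoluteValue K ℝ //
    v.comp (algebraMap ℚ K).injective = Rat.AbsoluteValue.real ∨
    ∃ (p : ℕ) (_ : Fact p.Prime),
      v.comp (algebraMap ℚ K).injective = Rat.AbsoluteValue.padic p}

/-- The local degree `[K_v : ℚ_v]`; here `ℚ_v`, the completion of `ℚ` at the restriction of `v`,
is realized as the topological closure of `ℚ` in the completion `K_v`. -/
def NumberFieldPlace.localDegree {K : Type u} [Field K] [CharZero K]
    (v : NumberFieldPlace K) : ℕ :=
  Module.finrank ((algebraMap ℚ v.1.Completion).fieldRange.topologicalClosure) v.1.Completion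

/-- The places of a function field `K` with constant field `k`: the surjective (that is,
normalized) discrete valuations of `K` that are trivial on `k`. The valuation is written
multiplicatively, so `val x` is `exp (-ord_v x)`. -/
structure FunctionFieldPlace {K : Type u} [Field K] (k : Subfield K) : Type u where
  val : Valuation K ℤᵐ⁰
  surjective : Function.Surjective val
  trivial_on_constants : ∀ a ∈ k, a ≠ 0 → val a = 1

namespace FunctionFieldPlace

variable {K : Type u} [Field K] {k : Subfield K}

theorem one_lt_toNNReal_exp : (1 : ℝ≥0) < Real.toNNReal (Real.exp 1) :=
  Real.one_lt_toNNReal.2 (Real.one_lt_exp_iff.2 one_pos)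

/-- The absolute value `|x|_v = e ^ (-ord_v x)`. -/
def absVal (v : FunctionFieldPlace k) : AbsoluteValue K ℝ where
  toFun x := (WithZeroMulInt.toNNReal one_lt_toNNReal_exp.ne_zero (v.val x) : ℝ)
  map_mul' x y := by simp
  nonneg' x := NNReal.coe_nonneg _
  eq_zero' x := by simp
  add_le' x y := by
    have hm := (WithZeroMulInt.toNNReal_strictMono one_lt_toNNReal_exp).monotone
    have h := hm (v.val.map_add x y)
    rw [hm.map_max] at h
    exact_mod_cast h.trans (max_le_add_of_nonneg zero_le zero_le)

/-- The embedding of the constant field into the residue field of `v`. -/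
def constantsToResidue (v : FunctionFieldPlace k) :
    k →+* IsLocalRing.ResidueField v.val.valuationSubring :=
  (IsLocalRing.residue v.val.valuationSubring).comp
    (k.subtype.codRestrict v.val.valuationSubring.toSubring fun a => by
      change v.val (a : K) ≤ 1
      by_cases h : (a : K) = 0
      · simp [h]
      · exact (v.trivial_on_constants a a.2 h).le)

/-- The degree of the place: the degree of its residue field over the constant field. -/
def degree (v : FunctionFieldPlace k) : ℕ :=
  Module.finrank v.constantsToResidue.fieldRange (IsLocalRing.ResidueField v.val.valuationSubring)

end FunctionFieldPlace

/-- A global field: a number field, or an algebraic function field in one variable over a finite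
field `k`, that is, a finite separable extension of `k(t)` with `t` transcendental over `k`. -/
inductive GlobalField (K : Type u) [Field K] : Type u
  | numberField (h : NumberField K)
  | functionField (k : Subfield K) (hk : Finite k)
      (h : ∃ t : K, Transcendental k t ∧
        FiniteDimensional (IntermediateField.adjoin k {t}) K ∧
        Algebra.IsSeparable (IntermediateField.adjoin k {t}) K)

namespace GlobalField

variable {K : Type u} [Field K]

/-- The set `M_K` of places. -/
def Place : GlobalField K → Type u
  | numberField _ => NumberFieldPlace K
  | functionField k _ _ => FunctionFieldPlace k

/-- The absolute value `|·|_v` on `K`. -/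
def absVal : (𝔎 : GlobalField K) → 𝔎.Place → AbsoluteValue K ℝ
  | numberField _, v => v.1
  | functionField _ _ _, v => FunctionFieldPlace.absVal v

/-- The local degree `n_v`. -/
def localDegree : (𝔎 : GlobalField K) → 𝔎.Place → ℕ
  | numberField _, v => NumberFieldPlace.localDegree v
  | functionField _ _ _, v => FunctionFieldPlace.degree v

/-- The completion `K_v`. -/
abbrev Completion (𝔎 : GlobalField K) (v : 𝔎.Place) : Type u := (𝔎.absVal v).Completion

/-- The Weil height on `ℙ¹(K)` (relative to `K`):
`h([x, y]) = ∑ v, n_v * log (max |x|_v |y|_v)`. -/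
def weilHeight (𝔎 : GlobalField K) (P : ℙ K (Fin 2 → K)) : ℝ :=
  ∑ᶠ v : 𝔎.Place, (𝔎.localDegree v : ℝ) *
    Real.log (max (𝔎.absVal v (P.rep 0)) (𝔎.absVal v (P.rep 1)))

end GlobalField

/-! ### Endomorphisms of the projective line and their lifts -/

/-- A lift to the affine plane of an endomorphism of `ℙ¹` over `K`: two forms of the same degree
without a common nontrivial zero over an algebraic closure. -/
structure Lift (K : Type u) [Field K] where
  degree : ℕ
  F : MvPolynomial (Fin 2) K
  G : MvPolynomial (Fin 2) K
  homogeneous_F : F.IsHomogeneous degree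
  homogeneous_G : G.IsHomogeneous degree
  eq_zero_of_common_zero : ∀ z : Fin 2 → AlgebraicClosure K,
    MvPolynomial.aeval z F = 0 → MvPolynomial.aeval z G = 0 → z = 0

namespace Lift

variable {K : Type u} [Field K]

/-- The polynomial map `𝔸²(A) → 𝔸²(A)` for a commutative `K`-algebra `A`. -/
def map (L : Lift K) {A : Type*} [CommRing A] [Algebra K A] (z : Fin 2 → A) : Fin 2 → A :=
  ![MvPolynomial.aeval z L.F, MvPolynomial.aeval z L.G]

theorem map_ne_zero (L : Lift K) {z : Fin 2 → K} (hz : z ≠ 0) : L.map z ≠ 0 := by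
  intro h
  apply hz
  have key : ∀ p : MvPolynomial (Fin 2) K, MvPolynomial.aeval z p = 0 →
      MvPolynomial.aeval (fun i => algebraMap K (AlgebraicClosure K) (z i)) p = 0 := by
    intro p hp
    have := MvPolynomial.aeval_algebraMap_apply (AlgebraicClosure K) z p
    rw [hp, _root_.map_zero] at this
    exact this
  have h0 := L.eq_zero_of_common_zero _ (key _ (congrFun h 0)) (key _ (congrFun h 1))
  funext i
  have := congrFun h0 i
  simpa using this

theorem aeval_smul_of_homogeneous {p : MvPolynomial (Fin 2) K} {d : ℕ} (hp : p.IsHomogeneous d)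
    (c : K) (z : Fin 2 → K) :
    MvPolynomial.aeval (c • z) p = c ^ d * MvPolynomial.aeval z p := by
  rw [MvPolynomial.aeval_def, MvPolynomial.aeval_def, MvPolynomial.eval₂_eq,
    MvPolynomial.eval₂_eq, Finset.mul_sum]
  refine Finset.sum_congr rfl fun m hm => ?_
  have hd := hp (MvPolynomial.mem_support_iff.1 hm)
  rw [Finsupp.weight_apply, Finsupp.sum_fintype _ _ (by simp)] at hd
  simp only [Pi.one_apply, smul_eq_mul, mul_one] at hd
  have hs : ∏ i ∈ m.support, c ^ m i = c ^ d := by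
    rw [Finset.prod_pow_eq_pow_sum, ← hd]
    congr 1
    exact Finset.sum_subset (Finset.subset_univ _) (by simp)
  simp only [Pi.smul_apply, smul_eq_mul, mul_pow, Finset.prod_mul_distrib, hs]
  ring

theorem map_smul (L : Lift K) (c : K) (z : Fin 2 → K) :
    L.map (c • z) = c ^ L.degree • L.map z := by
  funext i
  fin_cases i
  · simpa [map] using aeval_smul_of_homogeneous L.homogeneous_F c z
  · simpa [map] using aeval_smul_of_homogeneous L.homogeneous_G c z

/-- The map induced on `ℙ¹(K)`. -/
def act (L : Lift K) : ℙ K (Fin 2 → K) → ℙ K (Fin 2 → K) :=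
  Projectivization.lift (fun z => Projectivization.mk K (L.map z.1) (L.map_ne_zero z.2)) <| by
    rintro ⟨a, ha⟩ ⟨b, hb⟩ t (rfl : a = t • b)
    rw [Projectivization.mk_eq_mk_iff']
    exact ⟨t ^ L.degree, (L.map_smul t b).symm⟩

/-- Two lifts define the same endomorphism of `ℙ¹` exactly when they are proportional. -/
instance setoid (K : Type u) [Field K] : Setoid (Lift K) where
  r L L' := L.degree = L'.degree ∧ ∃ c : K, c ≠ 0 ∧ L.F = c • L'.F ∧ L.G = c • L'.G
  iseqv :=
    { refl := fun L => ⟨rfl, 1, one_ne_zero, by simp, by simp⟩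
      symm := by
        rintro L L' ⟨hd, c, hc, hF, hG⟩
        exact ⟨hd.symm, c⁻¹, inv_ne_zero hc, by simp [hF, smul_smul, hc],
          by simp [hG, smul_smul, hc]⟩
      trans := by
        rintro L L' L'' ⟨hd, c, hc, hF, hG⟩ ⟨hd', c', hc', hF', hG'⟩
        exact ⟨hd.trans hd', c * c', mul_ne_zero hc hc', by simp [hF, hF', smul_smul],
          by simp [hG, hG', smul_smul]⟩ }

theorem act_eq_of_equiv {L L' : Lift K} (h : L ≈ L') : L.act = L'.act := by
  obtain ⟨-, c, hc, hF, hG⟩ := h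
  funext P
  induction P using Projectivization.ind with
  | h z hz =>
    change Projectivization.mk K (L.map z) _ = Projectivization.mk K (L'.map z) _
    rw [Projectivization.mk_eq_mk_iff']
    refine ⟨c, ?_⟩
    funext i
    fin_cases i <;> simp [map, hF, hG]

/-- The composite `γ̃ₙ = θ̃ₙ ∘ ⋯ ∘ θ̃₁` on `𝔸²(A)`, where `γ̃ = (θ̃₁, θ̃₂, …)` and `θ̃ᵢ₊₁` is the
value of the sequence at `i`. -/
def iter (γ : ℕ → Lift K) {A : Type*} [CommRing A] [Algebra K A] (z : Fin 2 → A) :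
    ℕ → Fin 2 → A
  | 0 => z
  | n + 1 => (γ n).map (iter γ z n)

/-- The degree of `γ̃ₙ`. -/
def iterDegree (γ : ℕ → Lift K) (n : ℕ) : ℕ := ∏ i ∈ Finset.range n, (γ i).degree

end Lift

/-- Endomorphisms of `ℙ¹` over `K`: lifts up to nonzero constants. -/
def Endo (K : Type u) [Field K] : Type u := Quotient (Lift.setoid K)

namespace Endo

variable {K : Type u} [Field K]

/-- The endomorphism defined by a lift. -/
def ofLift (L : Lift K) : Endo K := Quotient.mk (Lift.setoid K) L

/-- The degree of an endomorphism. -/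
def degree : Endo K → ℕ := Quotient.lift Lift.degree fun _ _ h => h.1

/-- The action on `ℙ¹(K)`. -/
def act : Endo K → ℙ K (Fin 2 → K) → ℙ K (Fin 2 → K) :=
  Quotient.lift Lift.act fun _ _ h => Lift.act_eq_of_equiv h

/-- `γₙ · P = (θₙ ∘ ⋯ ∘ θ₁)(P)`, where `θᵢ₊₁` is the value of the sequence `γ` at `i`. -/
def iter (γ : ℕ → Endo K) (P : ℙ K (Fin 2 → K)) : ℕ → ℙ K (Fin 2 → K)
  | 0 => P
  | n + 1 => (γ n).act (iter γ P n)

/-- `deg γₙ`. -/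
def iterDegree (γ : ℕ → Endo K) (n : ℕ) : ℕ := ∏ i ∈ Finset.range n, (γ i).degree

end Endo

/-! ### Canonical heights and Green functions -/

namespace GlobalField

variable {K : Type u} [Field K] (𝔎 : GlobalField K)

/-- The terms `h(γₙ · P) / deg γₙ`. -/
def heightSeq (γ : ℕ → Endo K) (P : ℙ K (Fin 2 → K)) (n : ℕ) : ℝ :=
  𝔎.weilHeight (Endo.iter γ P n) / (Endo.iterDegree γ n : ℝ)

/-- The canonical height `ĥ_γ(P) = lim h(γₙ · P) / deg γₙ`. -/
def canonicalHeight (γ : ℕ → Endo K) (P : ℙ K (Fin 2 → K)) : ℝ :=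
  limUnder atTop (𝔎.heightSeq γ P)

/-- The norm `‖(x, y)‖_v = max |x|_v |y|_v` on `𝔸²(K_v)`. -/
def vnorm (v : 𝔎.Place) (z : Fin 2 → 𝔎.Completion v) : ℝ := max ‖z 0‖ ‖z 1‖

/-- The terms `log ‖γ̃ₙ(x, y)‖_v / deg γ̃ₙ`. -/
def greenSeq (v : 𝔎.Place) (γ : ℕ → Lift K) (z : Fin 2 → 𝔎.Completion v) (n : ℕ) : ℝ :=
  Real.log (𝔎.vnorm v (Lift.iter γ z n)) / (Lift.iterDegree γ n : ℝ)

/-- The Green function `𝒢_{v, γ̃}(x, y) = lim log ‖γ̃ₙ(x, y)‖_v / deg γ̃ₙ`. -/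
def green (v : 𝔎.Place) (γ : ℕ → Lift K) (z : Fin 2 → 𝔎.Completion v) : ℝ :=
  limUnder atTop (𝔎.greenSeq v γ z)

/-- The inclusion `𝔸²(K) → 𝔸²(K_v)`. -/
def embed (v : 𝔎.Place) (z : Fin 2 → K) : Fin 2 → 𝔎.Completion v :=
  fun i => algebraMap K (𝔎.Completion v) (z i)

end GlobalField

end RandomDynamics

end

/-!
The argument has a dynamical and an arithmetic half.

**Dynamics.** A lift `L` of degree `d` satisfies `|log ‖L z‖_v - d * log ‖z‖_v| ≤ c_v` at every
place, with `c_v = 0` for almost all `v` (`GlobalField.exists_bound_map`). The upper bound is the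
triangle inequality. The lower bound comes from the Nullstellensatz: the two forms have no common
zero over the algebraic closure, so powers of the coordinates are combinations of them
(`Lift.exists_pow_eq`). Taking the sum of the constants over the finite set `S`, consecutive terms
of the sequence that defines the Green function differ by at most `c_v / 2 ^ (n + 1)`, which gives
the limit and the first estimate (`GlobalField.tendsto_greenSeq`). For a point of `K²`, every map
preserves the norm at all places outside a finite set that does not depend on `n`, so
`h(γₙ · P) / deg γₙ` is the sum over this fixed finite set of the terms of the local sequences, and
the limit can be taken term by term. Here the product formula enters: it makes the height
independent of the representative (`GlobalField.weilHeight_mk`).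

**Arithmetic.** What is needed of a global field is that `|x|_v = 1` for almost all `v`, that almost
all `v` are nonarchimedean, and the product formula.

For number fields these are transferred from Mathlib's infinite places and primes. Archimedean
places are infinite places by the theorem of Gelfand and Mazur
(`NumberFieldPlace.exists_infinitePlace`). A place over `p` has a center `P` on the ring of
integers, which determines it. If `p` generates the ideal `P ^ e` locally at `P`, then
`𝓞 K ⧸ P ^ e` is the unit ball of the completion modulo `p`, and lifts of an `𝔽_p`-basis
of it form a basis of the completion over the closure of `ℚ` (`card_quotient_eq_pow_finrank`).
So `p ^ n_v = N(P) ^ e`, and `|x|_v ^ n_v` is the `P`-adic absolute value normalized by `N(P)`.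

For function fields, if `K / k(x)` is finite separable, then the places with `|x|_v < 1` are those
of the primes above `x` of the integral closure of `k[x]`, and the fundamental identity for
ramification indices and inertia degrees shows that the divisor of zeros of `x` has degree
`[K : k(x)]` (`FunctionFieldPlace.finsum_degree_mul_log_of_lt_one`). Applied to
`x⁻¹` as well, this gives the product formula for such `x`. Every other nonzero `x` has
`dx = 0` in the one-dimensional space of Kähler differentials; then `d(x * t) = x * dt ≠ 0`
for a separating element `t`, so that `x` is the quotient of the separating elements `x * t` and `t`.
-/

namespace RandomDynamics

open scoped NumberField

/-! ### Valuations of the fraction field of a Dedekind domain -/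

section Dedekind

open IsDedekindDomain

/-- A valuation that is at most `1` on `B`, and not always `1`, has a center: the prime ideal of the
elements of `B` at which it is less than `1`. -/
theorem exists_heightOneSpectrum_center {B K : Type*} [CommRing B] [Field K] [Algebra B K]
    {Γ : Type*} [LinearOrderedCommGroupWithZero Γ] (w : Valuation K Γ)
    (hle : ∀ b : B, w (algebraMap B K b) ≤ 1) (hlt : ∃ b : B, b ≠ 0 ∧ w (algebraMap B K b) < 1) :
    ∃ P : HeightOneSpectrum B, ∀ b : B, b ∈ P.asIdeal ↔ w (algebraMap B K b) < 1 := by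
  let I : Ideal B :=
    { carrier := {b | w (algebraMap B K b) < 1}
      add_mem' := fun {a b} ha hb => by
        simp only [Set.mem_ofPred_eq, map_add] at *
        exact w.map_add_lt ha hb
      zero_mem' := by simp
      smul_mem' := fun c b hb => by
        simp only [Set.mem_ofPred_eq, smul_eq_mul, map_mul] at *
        exact (mul_le_of_le_one_left' (hle c)).trans_lt hb }
  have hI : ∀ b, b ∈ I ↔ w (algebraMap B K b) < 1 := fun b => Iff.rfl
  refine ⟨⟨I, ?_, ?_⟩, hI⟩
  · refine ⟨fun h => ?_, fun {a b} hab => ?_⟩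
    · have := (hI 1).1 (h ▸ Submodule.mem_top)
      simp at this
    · rw [hI, hI, ← not_le, ← not_le, ← not_and_or]
      rintro ⟨ha, hb⟩
      have := (hI _).1 hab
      rw [map_mul, map_mul] at this
      exact absurd this (not_lt.2 (one_le_mul ha hb))
  · obtain ⟨b, hb0, hb⟩ := hlt
    exact fun h => hb0 (by simpa [h] using (hI b).2 hb)

variable {B K : Type*} [CommRing B] [IsDedekindDomain B] [Field K] [Algebra B K]
  [IsFractionRing B K] {Γ : Type*} [LinearOrderedCommGroupWithZero Γ]

variable (P : HeightOneSpectrum B)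

/-- The center determines the valuation up to equivalence, as the local ring at a prime of a
Dedekind domain is already a valuation ring. -/
theorem isEquiv_valuation_of_center {w : Valuation K Γ} (hle : ∀ b : B, w (algebraMap B K b) ≤ 1)
    (hP : ∀ b : B, b ∈ P.asIdeal ↔ w (algebraMap B K b) < 1) : (P.valuation K).IsEquiv w := by
  have key : ∀ z : K, P.valuation K z ≤ 1 → ∃ n d : B, d ∉ P.asIdeal ∧ w z = w (algebraMap B K n) ∧
      P.valuation K z = P.valuation K (algebraMap B K n) := by
    intro z hz
    obtain ⟨n, d, h⟩ := P.exists_primeCompl_mul_eq_of_integer z hz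
    have hd : (d : B) ∉ P.asIdeal := d.2
    have hd1 : w (algebraMap B K d) = 1 := (hle d).eq_of_not_lt fun h => hd ((hP d).2 h)
    have hd2 : P.valuation K (algebraMap B K d) = 1 :=
      (HeightOneSpectrum.valuation_eq_one_iff_notMem P).2 hd
    refine ⟨n, d, hd, ?_, ?_⟩
    · rw [← h, map_mul, hd1, mul_one]
    · rw [← h, map_mul, hd2, mul_one]
  refine Valuation.isEquiv_iff_val_lt_one.2 fun {z} => ⟨fun hz => ?_, fun hz => ?_⟩
  · obtain ⟨n, d, hd, h1, h2⟩ := key z hz.le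
    rw [h1]
    rw [h2] at hz
    exact (hP n).1 ((HeightOneSpectrum.valuation_lt_one_iff_mem P n).1 hz)
  · by_contra hz'
    rw [not_lt] at hz'
    have hz0 : z ≠ 0 := fun h => by simp [h] at hz'
    obtain ⟨n, d, hd, h1, -⟩ := key z⁻¹ (by rw [map_inv₀]; exact inv_le_one_of_one_le₀ hz')
    have h3 := hle n
    rw [← h1, map_inv₀] at h3
    exact absurd hz (not_lt.2 ((inv_le_one₀ (zero_lt_iff.2 (by simpa using hz0))).1 h3))

/-- A valuation that is equivalent to a `P`-adic one is determined by its value at a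
uniformizer. -/
theorem eq_zpow_of_isEquiv {w : Valuation K Γ} (h : (P.valuation K).IsEquiv w) {π : K}
    (hπ : P.valuation K π = WithZero.exp (-1 : ℤ)) {y : K} {n : ℤ}
    (hy : P.valuation K y = WithZero.exp (-n)) : w y = w π ^ n := by
  have hπ0 : π ≠ 0 := fun h0 => WithZero.exp_ne_zero (by rw [← hπ, h0, map_zero])
  have h1 : P.valuation K (y / π ^ n) = 1 := by
    rw [map_div₀, map_zpow₀, hπ, hy, ← WithZero.exp_zsmul]
    simp
  have h2 : w (y / π ^ n) = 1 := h.eq_one_iff_eq_one.1 h1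
  rw [map_div₀, map_zpow₀, div_eq_one_iff_eq (zpow_ne_zero _ (by simpa using hπ0))] at h2
  exact h2

theorem exists_valuation_eq_exp_neg {y : K} (hy : y ≠ 0) :
    ∃ n : ℤ, P.valuation K y = WithZero.exp (-n) := by
  refine ⟨-WithZero.log (P.valuation K y), ?_⟩
  rw [neg_neg, WithZero.exp_log (by simpa using hy)]

end Dedekind

/-! ### Nonarchimedean absolute values and completions -/

theorem toNNReal_exp {e : NNReal} (he : e ≠ 0) (n : ℤ) :
    WithZeroMulInt.toNNReal he (WithZero.exp n) = e ^ n := by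
  rw [WithZeroMulInt.toNNReal_neg_apply _ WithZero.exp_ne_zero]
  rfl

/-- A nonarchimedean absolute value as a valuation. -/
noncomputable def valuationOfIsNonarchimedean {K : Type*} [Field K] {v : AbsoluteValue K ℝ}
    (hv : IsNonarchimedean v) : Valuation K NNReal where
  toFun x := (v x).toNNReal
  map_zero' := by simp
  map_one' := by simp
  map_mul' x y := by rw [map_mul, Real.toNNReal_mul (v.nonneg x)]
  map_add_le_max' x y := by
    rw [← Monotone.map_max (f := Real.toNNReal) fun _ _ h => Real.toNNReal_mono h]
    exact Real.toNNReal_mono (hv x y)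

theorem valuationOfIsNonarchimedean_apply {K : Type*} [Field K] {v : AbsoluteValue K ℝ}
    (hv : IsNonarchimedean v) (x : K) : (valuationOfIsNonarchimedean hv x : ℝ) = v x :=
  Real.coe_toNNReal _ (v.nonneg x)

theorem norm_algebraMap_completion {K : Type*} [Field K] (v : AbsoluteValue K ℝ) (x : K) :
    ‖algebraMap K v.Completion x‖ = v x :=
  UniformSpace.Completion.norm_coe (WithAbs.toAbs v x)

theorem isUltrametricDist_completion {K : Type*} [Field K] {v : AbsoluteValue K ℝ}
    (hv : IsNonarchimedean v) : IsUltrametricDist v.Completion := by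
  refine IsUltrametricDist.isUltrametricDist_of_isNonarchimedean_norm fun a b => ?_
  induction a, b using UniformSpace.Completion.induction_on₂ with
  | hp => exact isClosed_le (by fun_prop) (by fun_prop)
  | ih a b =>
    rw [← UniformSpace.Completion.coe_add, UniformSpace.Completion.norm_coe,
      UniformSpace.Completion.norm_coe, UniformSpace.Completion.norm_coe]
    exact hv a.ofAbs b.ofAbs

/-! ### Archimedean places of a number field -/

section ArchimedeanCompletion

variable {E : Type*} [NormedField E]

/-- A homomorphism of normed fields that is bounded is norm-decreasing, because the bound applies
to all powers of an element. -/
theorem norm_map_le_of_bound {F : Type*} [NormedField F] (φ : E →+* F) {C : ℝ}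
    (hC : ∀ x, ‖φ x‖ ≤ C * ‖x‖) (x : E) : ‖φ x‖ ≤ ‖x‖ := by
  by_contra! h
  have hx : 0 < ‖x‖ := by
    refine norm_pos_iff.2 fun h0 => ?_
    simp [h0] at h
  have hr : 1 < ‖φ x‖ / ‖x‖ := (one_lt_div hx).2 h
  obtain ⟨n, hn⟩ := pow_unbounded_of_one_lt C hr
  have := hC (x ^ n)
  rw [map_pow, norm_pow, norm_pow] at this
  rw [div_pow, lt_div_iff₀ (pow_pos hx n)] at hn
  linarith

theorem norm_algEquiv_eq {F : Type*} [NormedField F] [NormedAlgebra ℝ E] [NormedAlgebra ℝ F]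
    [FiniteDimensional ℝ F] (e : E ≃ₐ[ℝ] F) (x : E) : ‖e x‖ = ‖x‖ := by
  have : FiniteDimensional ℝ E := e.symm.toLinearEquiv.finiteDimensional
  have h1 : ∀ x, ‖e x‖ ≤ ‖x‖ := fun x =>
    norm_map_le_of_bound (e : E →+* F)
      (fun x => (e.toLinearMap.toContinuousLinearMap).le_opNorm x) x
  have h2 : ∀ y, ‖e.symm y‖ ≤ ‖y‖ := fun y =>
    norm_map_le_of_bound (e.symm : F →+* E)
      (fun x => (e.symm.toLinearMap.toContinuousLinearMap).le_opNorm x) y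
  refine (h1 x).antisymm ?_
  simpa using h2 (e x)

theorem exists_isometry_real [CompleteSpace E] (h : ∀ q : ℚ, ‖(q : E)‖ = |(q : ℝ)|) :
    ∃ j : ℝ →+* E, Isometry j := by
  have : CharZero E := by
    refine charZero_of_inj_zero fun n hn => ?_
    have := h n
    rw [Rat.cast_natCast, hn, norm_zero] at this
    simpa using this.symm
  have hi : Isometry (Rat.castHom E) := by
    refine AddMonoidHomClass.isometry_of_norm _ fun q => ?_
    rw [Rat.coe_castHom, h q, ← Real.norm_eq_abs, Rat.norm_cast_real]
  have hu : IsUniformInducing (Rat.castHom ℝ) := Rat.isUniformEmbedding_coe_real.isUniformInducing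
  have hd : DenseRange (Rat.castHom ℝ) := Rat.isDenseEmbedding_coe_real.dense
  refine ⟨IsDenseInducing.extendRingHom hu hd hi.uniformContinuous, ?_⟩
  have hc : Continuous (IsDenseInducing.extendRingHom hu hd hi.uniformContinuous) :=
    (uniformContinuous_uniformly_extend hu hd hi.uniformContinuous).continuous
  refine AddMonoidHomClass.isometry_of_norm _ fun r => ?_
  refine congrFun (hd.equalizer hc.norm continuous_norm (funext fun q => ?_)) r
  have : IsDenseInducing.extendRingHom hu hd hi.uniformContinuous (Rat.castHom ℝ q) = (q : E) :=
    map_ratCast _ q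
  simp only [Function.comp_apply]
  rw [this, h q]
  exact (Real.norm_eq_abs _).symm

theorem topologicalClosure_fieldRange_rat [Algebra ℚ E] {j : ℝ →+* E} (hj : Isometry j) :
    (algebraMap ℚ E).fieldRange.topologicalClosure = j.fieldRange := by
  apply le_antisymm
  · refine Subfield.topologicalClosure_minimal _ ?_ ?_
    · rintro _ ⟨q, rfl⟩
      exact ⟨q, by simp⟩
    · rw [RingHom.coe_fieldRange]
      exact hj.isClosedEmbedding.isClosed_range
  · rintro _ ⟨r, rfl⟩
    refine Rat.isDenseEmbedding_coe_real.dense.induction_on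
      (p := fun r => j r ∈ (algebraMap ℚ E).fieldRange.topologicalClosure) r ?_ fun q => ?_
    · exact (Subfield.isClosed_topologicalClosure _).preimage hj.continuous
    · exact Subfield.le_topologicalClosure _ ⟨q, by simp⟩

theorem finrank_eq_of_eq_fieldRange {R E F : Type*} [Field R] [Field E] [Field F] [Algebra R F]
    {A : Subfield E} {j : R →+* E} (h : A = j.fieldRange) (e : E ≃+* F)
    (he : ∀ r, e (j r) = algebraMap R F r) : Module.finrank A E = Module.finrank R F := by
  subst h
  refine (Algebra.finrank_eq_of_equiv_equiv (RingHom.rangeRestrictFieldEquiv j) e.symm ?_).symm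
  ext r
  rw [RingHom.comp_apply, RingHom.comp_apply]
  change j r = e.symm (algebraMap R F r)
  rw [← he r, e.symm_apply_apply]

end ArchimedeanCompletion

namespace NumberFieldPlace

open NumberField

variable {K : Type*} [Field K] [NumberField K]

theorem norm_ratCast_completion (v : AbsoluteValue K ℝ) (q : ℚ) :
    ‖(q : v.Completion)‖ = v.comp (algebraMap ℚ K).injective q := by
  have : (q : v.Completion) = algebraMap K v.Completion (algebraMap ℚ K q) := by simp
  rw [this]
  exact norm_algebraMap_completion v _

/-- Ostrowski's theorem for the archimedean absolute values of a number field, with the local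
degree: the completion is `ℝ` or `ℂ` by the theorem of Gelfand and Mazur. -/
theorem exists_infinitePlace (v : NumberFieldPlace K)
    (hv : v.1.comp (algebraMap ℚ K).injective = Rat.AbsoluteValue.real) :
    ∃ w : InfinitePlace K, w.1 = v.1 ∧ v.localDegree = w.mult := by
  have hq : ∀ q : ℚ, ‖(q : v.1.Completion)‖ = |(q : ℝ)| := fun q => by
    rw [norm_ratCast_completion, hv]; rfl
  obtain ⟨j, hj⟩ := exists_isometry_real hq
  have hcl := topologicalClosure_fieldRange_rat hj
  let _ : NormedAlgebra ℝ v.1.Completion :=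
    { j.toAlgebra with
      norm_smul_le := fun r x => by
        change ‖j r * x‖ ≤ _
        rw [norm_mul, hj.norm_map_of_map_zero (map_zero j)] }
  have hmap : ∀ r, algebraMap ℝ v.1.Completion r = j r := fun r => rfl
  have hnorm := norm_algebraMap_completion v.1
  rcases NormedAlgebra.Real.nonempty_algEquiv_or v.1.Completion with ⟨⟨e⟩⟩ | ⟨⟨e⟩⟩
  · set φ : K →+* ℂ := (algebraMap ℝ ℂ).comp ((e : v.1.Completion →+* ℝ).comp
      (algebraMap K v.1.Completion)) with hφ
    have hre : ComplexEmbedding.IsReal φ := by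
      rw [ComplexEmbedding.isReal_iff]
      ext x
      simp [hφ, ComplexEmbedding.conjugate_coe_eq]
    refine ⟨InfinitePlace.mk φ, ?_, ?_⟩
    · ext x
      change ‖φ x‖ = _
      rw [← hnorm x, ← norm_algEquiv_eq e]
      simp [hφ]
    · rw [InfinitePlace.mult, if_pos (InfinitePlace.isReal_mk_iff.2 hre)]
      exact (finrank_eq_of_eq_fieldRange hcl e.toRingEquiv e.commutes).trans
        (Module.finrank_self ℝ)
  · set φ : K →+* ℂ := (e : v.1.Completion →+* ℂ).comp (algebraMap K v.1.Completion) with hφ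
    have hre : ¬ ComplexEmbedding.IsReal φ := by
      intro hre
      have hce : Continuous e :=
        (AddMonoidHomClass.isometry_of_norm e (norm_algEquiv_eq e)).continuous
      have hall : ∀ x, (starRingEnd ℂ) (e x) = e x := by
        refine fun x => UniformSpace.Completion.induction_on x
          (isClosed_eq (Complex.continuous_conj.comp hce) hce) fun a => ?_
        exact RingHom.congr_fun ((ComplexEmbedding.isReal_iff).1 hre) a.ofAbs
      have := hall (e.symm Complex.I)
      rw [e.apply_symm_apply, Complex.conj_I] at this
      have h2 := congrArg Complex.im this
      norm_num at h2
    refine ⟨InfinitePlace.mk φ, ?_, ?_⟩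
    · ext x
      change ‖φ x‖ = _
      rw [← hnorm x, ← norm_algEquiv_eq e]
      rfl
    · rw [InfinitePlace.mult, if_neg fun h => hre (InfinitePlace.isReal_mk_iff.1 h)]
      exact (finrank_eq_of_eq_fieldRange hcl e.toRingEquiv e.commutes).trans
        Complex.finrank_real_complex

theorem infinitePlace_comp_rat (w : InfinitePlace K) :
    w.1.comp (algebraMap ℚ K).injective = Rat.AbsoluteValue.real := by
  ext q
  change w (algebraMap ℚ K q) = |(q : ℝ)|
  rw [← InfinitePlace.norm_embedding_eq]
  simp

end NumberFieldPlace

/-! ### The degree of a complete field over a `p`-adic subfield -/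

section ResidueDegree

variable {E : Type*} [NormedField E] [IsUltrametricDist E] [CompleteSpace E]

/-- Let `F` be a closed subfield of `E` that has residue field `𝔽_p` and in which `p` is a
uniformizer. If `R ⊆ E` is dense in the unit ball modulo `p`, then lifts of an `𝔽_p`-basis of the
unit ball modulo `p` to `R` form an `F`-basis of `E`. -/
theorem card_quotient_eq_pow_finrank (F : Subfield E) (hFc : IsClosed (F : Set E)) {p : ℕ}
    [hp : Fact p.Prime] (hpE : ‖(p : E)‖ = (p : ℝ)⁻¹)
    (hF : ∀ a ∈ F, ‖a‖ ≤ 1 → ∃ n : ℤ, ‖a - n‖ ≤ (p : ℝ)⁻¹)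
    {R : Type*} [CommRing R] (f : R →+* E) (hf1 : ∀ b, ‖f b‖ ≤ 1)
    (hf : ∀ x, ‖x‖ ≤ 1 → ∃ b : R, ‖x - f b‖ ≤ (p : ℝ)⁻¹)
    (I : Ideal R) [Finite (R ⧸ I)] (hI : ∀ b, b ∈ I ↔ ‖f b‖ ≤ (p : ℝ)⁻¹) :
    Nat.card (R ⧸ I) = p ^ Module.finrank F E := by
  classical
  have hp1 : (1 : ℝ) < p := by exact_mod_cast hp.out.one_lt
  have hp0 : (0 : ℝ) < p := zero_lt_one.trans hp1
  have hpi : (p : ℝ)⁻¹ < 1 := inv_lt_one_of_one_lt₀ hp1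
  have hpE0 : (p : E) ≠ 0 := fun h => by
    rw [h, norm_zero] at hpE
    exact (inv_pos.2 hp0).ne hpE
  have hint : ∀ n : ℤ, ‖(n : E)‖ ≤ 1 := fun n => by simpa using hf1 n
  have hpR : ∀ x : R ⧸ I, p • x = 0 := fun x => by
    obtain ⟨b, rfl⟩ := Ideal.Quotient.mk_surjective x
    rw [nsmul_eq_mul, ← map_natCast (Ideal.Quotient.mk I), ← map_mul,
      Ideal.Quotient.eq_zero_iff_mem, hI, map_mul, norm_mul, map_natCast, hpE]
    exact mul_le_of_le_one_right (inv_nonneg.2 hp0.le) (hf1 b)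
  have _ : Module (ZMod p) (R ⧸ I) := AddCommGroup.zmodModule hpR
  let bas := Module.finBasis (ZMod p) (R ⧸ I)
  set m := Module.finrank (ZMod p) (R ⧸ I) with hm
  choose β hβ using fun i => Ideal.Quotient.mk_surjective (bas i)
  have hcast : ∀ (n : ℤ) (i : Fin m), Ideal.Quotient.mk I (n * β i) = (n : ZMod p) • bas i := by
    intro n i
    rw [map_mul, hβ, map_intCast, Int.cast_smul_eq_zsmul, zsmul_eq_mul]
  -- a combination with integral coefficients is divisible by `p` only if all coefficients are
  have hdvd : ∀ n : Fin m → ℤ, ‖∑ i, (n i : E) * f (β i)‖ ≤ (p : ℝ)⁻¹ → ∀ i, (p : ℤ) ∣ n i := by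
    intro n hn i
    have h1 : (∑ i, (n i : R) * β i) ∈ I := (hI _).2 (by simpa using hn)
    rw [← Ideal.Quotient.eq_zero_iff_mem, map_sum] at h1
    simp only [hcast] at h1
    exact (ZMod.intCast_zmod_eq_zero_iff_dvd _ _).1 (Fintype.linearIndependent_iff.1
      bas.linearIndependent _ h1 i)
  have hspan1 : ∀ x : E, ‖x‖ ≤ 1 → ∃ n : Fin m → ℤ, ‖x - ∑ i, (n i : E) * f (β i)‖ ≤ (p : ℝ)⁻¹ := by
    intro x hx
    obtain ⟨b, hb⟩ := hf x hx
    refine ⟨fun i => ((bas.repr (Ideal.Quotient.mk I b) i).val : ℤ), ?_⟩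
    have hbI : b - ∑ i, (((bas.repr (Ideal.Quotient.mk I b) i).val : ℤ) : R) * β i ∈ I := by
      rw [← Ideal.Quotient.eq_zero_iff_mem, map_sub, map_sum]
      simp only [hcast]
      simp only [Int.cast_natCast, ZMod.natCast_zmod_val]
      rw [bas.sum_repr, sub_self]
    have h2 := (hI _).1 hbI
    simp only [map_sub, map_sum, map_mul, map_intCast] at h2
    have := (IsUltrametricDist.norm_add_le_max (x - f b)
      (f b - ∑ i, (((bas.repr (Ideal.Quotient.mk I b) i).val : ℤ) : E) * f (β i))).trans
      (max_le hb h2)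
    rwa [sub_add_sub_cancel] at this
  -- after division by a coefficient of largest norm, a relation over `F` is congruent modulo `p` to
  -- one with integral coefficients, not all of them divisible by `p`
  have hli : LinearIndependent F fun i => f (β i) := by
    rw [Fintype.linearIndependent_iff]
    intro g hg
    by_contra! hne
    obtain ⟨i₀, hi₀⟩ := hne
    obtain ⟨j, -, hj⟩ := Finset.exists_max_image Finset.univ (fun i => ‖(g i : E)‖)
      ⟨i₀, Finset.mem_univ _⟩
    have hgj : (g j : E) ≠ 0 := fun h => hi₀ (by
      have := hj i₀ (Finset.mem_univ _)
      rw [h, norm_zero] at this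
      exact Subtype.ext (norm_le_zero_iff.1 this))
    have hint' : ∀ i, ∃ n : ℤ, ‖(g i / g j : E) - n‖ ≤ (p : ℝ)⁻¹ := fun i => by
      refine hF _ (F.div_mem (g i).2 (g j).2) ?_
      rw [norm_div]
      exact div_le_one_of_le₀ (hj i (Finset.mem_univ _)) (norm_nonneg _)
    choose n hn using hint'
    have hsum : ∑ i, (g i / g j : E) * f (β i) = 0 := by
      have : ∑ i, (g i : E) * f (β i) = 0 := hg
      simp_rw [div_mul_eq_mul_div]
      rw [← Finset.sum_div, this, zero_div]
    have hnorm : ‖∑ i, (n i : E) * f (β i)‖ ≤ (p : ℝ)⁻¹ := by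
      rw [← norm_neg, ← zero_sub, ← hsum, ← Finset.sum_sub_distrib]
      refine IsUltrametricDist.norm_sum_le_of_forall_le_of_nonneg (inv_nonneg.2 hp0.le)
        fun i _ => ?_
      rw [← sub_mul, norm_mul]
      exact (mul_le_of_le_one_right (norm_nonneg _) (hf1 _)).trans (hn i)
    obtain ⟨c, hc⟩ := hdvd n hnorm j
    have h1 : ‖(n j : E)‖ ≤ (p : ℝ)⁻¹ := by
      rw [hc, Int.cast_mul, norm_mul, Int.cast_natCast, hpE]
      exact mul_le_of_le_one_right (inv_nonneg.2 hp0.le) (hint c)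
    have h2 := hn j
    rw [div_self hgj] at h2
    have h3 := (IsUltrametricDist.norm_add_le_max ((1 : E) - n j) (n j)).trans (max_le h2 h1)
    rw [sub_add_cancel, norm_one] at h3
    exact absurd h3 (not_le.2 hpi)
  have hsp : ⊤ ≤ Submodule.span F (Set.range fun i => f (β i)) := by
    set W := Submodule.span F (Set.range fun i => f (β i)) with hW
    have hFmem : ∀ (c : E) (_ : c ∈ F) (w : E), w ∈ W → c * w ∈ W := fun c hc w hw =>
      W.smul_mem (⟨c, hc⟩ : F) hw
    have happrox : ∀ (k : ℕ) (x : E), ‖x‖ ≤ 1 → ∃ w ∈ W, ‖x - w‖ ≤ (p : ℝ)⁻¹ ^ k := by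
      intro k
      induction k with
      | zero => exact fun x hx => ⟨0, W.zero_mem, by simpa using hx⟩
      | succ k ih =>
        intro x hx
        obtain ⟨w, hw, hxw⟩ := ih x hx
        have hpk : (p : E) ^ k ≠ 0 := pow_ne_zero _ hpE0
        obtain ⟨n, hn⟩ := hspan1 ((x - w) / (p : E) ^ k) (by
          rw [norm_div, norm_pow, hpE]
          exact div_le_one_of_le₀ hxw (by positivity))
        refine ⟨w + (p : E) ^ k * ∑ i, (n i : E) * f (β i), W.add_mem hw
          (hFmem _ (pow_mem (natCast_mem F p) k) _ (W.sum_mem fun i _ =>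
            hFmem _ (intCast_mem F _) _ (Submodule.subset_span ⟨i, rfl⟩))), ?_⟩
        have : x - (w + (p : E) ^ k * ∑ i, (n i : E) * f (β i)) =
            (p : E) ^ k * ((x - w) / (p : E) ^ k - ∑ i, (n i : E) * f (β i)) := by
          field_simp
          ring
        rw [this, norm_mul, norm_pow, hpE, pow_succ]
        exact mul_le_mul_of_nonneg_left hn (by positivity)
    let _ : NontriviallyNormedField F :=
      { (inferInstance : NormedField F) with
        non_trivial := ⟨(p : F)⁻¹, by
          change 1 < ‖((p : F)⁻¹ : E)‖
          have : ‖((p : E))⁻¹‖ = p := by rw [norm_inv, hpE, inv_inv]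
          simpa [this] using hp1⟩ }
    let _ : NormedSpace F E :=
      { norm_smul_le := fun a x => (norm_mul (a : E) x).le }
    have : CompleteSpace F := hFc.completeSpace_coe
    have hfd : FiniteDimensional F W := FiniteDimensional.span_of_finite F (Set.finite_range _)
    have hWc : IsClosed (W : Set E) := W.closed_of_finiteDimensional
    -- `W` is finite-dimensional over the complete field `F`, hence closed
    have hball : ∀ x : E, ‖x‖ ≤ 1 → x ∈ W := by
      intro x hx
      rw [← SetLike.mem_coe, ← hWc.closure_eq, Metric.mem_closure_iff]
      intro ε hε
      obtain ⟨k, hk⟩ := exists_pow_lt_of_lt_one hε hpi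
      obtain ⟨w, hw, h⟩ := happrox k x hx
      exact ⟨w, hw, by rw [dist_eq_norm]; exact h.trans_lt hk⟩
    intro x _
    obtain ⟨k, hk⟩ := pow_unbounded_of_one_lt ‖x‖ hp1
    have h1 := hball ((p : E) ^ k * x) (by
      rw [norm_mul, norm_pow, hpE, inv_pow, inv_mul_le_iff₀ (by positivity), mul_one]
      exact hk.le)
    have h2 := hFmem (((p : E) ^ k)⁻¹) (F.inv_mem (pow_mem (natCast_mem F p) k)) _ h1
    rwa [inv_mul_cancel_left₀ (pow_ne_zero _ hpE0)] at h2
  have hfr : Module.finrank F E = m := by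
    simpa using Module.finrank_eq_card_basis (Module.Basis.mk hli hsp)
  rw [hfr, hm]
  have := Module.natCard_eq_pow_finrank (K := ZMod p) (V := R ⧸ I)
  rwa [Nat.card_zmod] at this

end ResidueDegree

/-! ### Nonarchimedean places of a number field -/

theorem norm_sub_le_max_norm {G : Type*} [SeminormedAddCommGroup G] [IsUltrametricDist G]
    (x y : G) : ‖x - y‖ ≤ max ‖x‖ ‖y‖ := by
  simpa [sub_eq_add_neg] using IsUltrametricDist.norm_add_le_max x (-y)

namespace NumberFieldPlace

open NumberField IsDedekindDomain

variable {K : Type*} [Field K] [NumberField K]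

theorem apply_ratCast_of_padic {v : AbsoluteValue K ℝ} {p : ℕ} [Fact p.Prime]
    (hv : v.comp (algebraMap ℚ K).injective = Rat.AbsoluteValue.padic p) (q : ℚ) :
    v (q : K) = padicNorm p q := by
  have := DFunLike.congr_fun hv q
  rw [Rat.AbsoluteValue.padic_eq_padicNorm] at this
  rw [← this]
  change _ = v (algebraMap ℚ K q)
  rw [eq_ratCast]

theorem apply_prime_of_padic {v : AbsoluteValue K ℝ} {p : ℕ} [hp : Fact p.Prime]
    (hv : v.comp (algebraMap ℚ K).injective = Rat.AbsoluteValue.padic p) :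
    v (p : K) = (p : ℝ)⁻¹ := by
  have := apply_ratCast_of_padic hv p
  rw [padicNorm.padicNorm_p hp.out.one_lt] at this
  simpa using this

theorem isNonarchimedean_of_padic {v : AbsoluteValue K ℝ} {p : ℕ} [Fact p.Prime]
    (hv : v.comp (algebraMap ℚ K).injective = Rat.AbsoluteValue.padic p) :
    IsNonarchimedean v := by
  have h : IsUltrametricDist (WithAbs v) := by
    refine IsUltrametricDist.isUltrametricDist_of_forall_norm_natCast_le_one fun n => ?_
    have h1 := apply_ratCast_of_padic hv n
    have h2 : ((padicNorm p (n : ℚ) : ℚ) : ℝ) ≤ 1 := by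
      exact_mod_cast padicNorm.of_int (p := p) n
    rw [← h1, Rat.cast_natCast] at h2
    exact h2
  intro x y
  exact IsUltrametricDist.norm_add_le_max (WithAbs.toAbs v x) (WithAbs.toAbs v y)

theorem apply_ringOfIntegers_le_one {K : Type*} [Field K] {v : AbsoluteValue K ℝ}
    (hv : IsNonarchimedean v) (b : 𝓞 K) :
    v (algebraMap (𝓞 K) K b) ≤ 1 := by
  have hint : IsIntegral (valuationOfIsNonarchimedean hv).integer (algebraMap (𝓞 K) K b) :=
    b.2.tower_top
  have := (Valuation.integer.integers (valuationOfIsNonarchimedean hv)).mem_of_integral hint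
  rw [← valuationOfIsNonarchimedean_apply hv]
  exact_mod_cast this

theorem valuation_natCast (P : HeightOneSpectrum (𝓞 K)) (n : ℕ) :
    P.valuation K (n : K) = P.intValuation (n : 𝓞 K) :=
  (congrArg (P.valuation K) (map_natCast (algebraMap (𝓞 K) K) n).symm).trans
    (P.valuation_of_algebraMap _)

/-- The center on the ring of integers of an absolute value that extends a `p`-adic one. -/
theorem exists_center {v : AbsoluteValue K ℝ} {p : ℕ} [hp : Fact p.Prime]
    (hv : v.comp (algebraMap ℚ K).injective = Rat.AbsoluteValue.padic p) :
    ∃ P : HeightOneSpectrum (𝓞 K), ∀ b : 𝓞 K, b ∈ P.asIdeal ↔ v (algebraMap (𝓞 K) K b) < 1 := by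
  have hna := isNonarchimedean_of_padic hv
  have hlt : ∀ x : K, valuationOfIsNonarchimedean hna x < 1 ↔ v x < 1 := fun x => by
    rw [← valuationOfIsNonarchimedean_apply hna]
    exact_mod_cast Iff.rfl
  have hle : ∀ x : K, valuationOfIsNonarchimedean hna x ≤ 1 ↔ v x ≤ 1 := fun x => by
    rw [← valuationOfIsNonarchimedean_apply hna]
    exact_mod_cast Iff.rfl
  obtain ⟨P, hP⟩ := exists_heightOneSpectrum_center (B := 𝓞 K) (valuationOfIsNonarchimedean hna)
    (fun b => (hle _).2 (apply_ringOfIntegers_le_one hna b))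
    ⟨(p : 𝓞 K), by exact_mod_cast hp.out.ne_zero, by
      rw [hlt, map_natCast, apply_prime_of_padic hv]
      exact inv_lt_one_of_one_lt₀ (by exact_mod_cast hp.out.one_lt)⟩
  exact ⟨P, fun b => (hP b).trans (hlt _)⟩

section Center

variable {v : AbsoluteValue K ℝ} {p : ℕ} [hp : Fact p.Prime] {P : HeightOneSpectrum (𝓞 K)}

theorem isEquiv_of_center
    (hv : v.comp (algebraMap ℚ K).injective = Rat.AbsoluteValue.padic p)
    (hP : ∀ b : 𝓞 K, b ∈ P.asIdeal ↔ v (algebraMap (𝓞 K) K b) < 1) :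
    (P.valuation K).IsEquiv (valuationOfIsNonarchimedean (isNonarchimedean_of_padic hv)) := by
  have hna := isNonarchimedean_of_padic hv
  refine isEquiv_valuation_of_center P (fun b => ?_) fun b => ?_
  · rw [← NNReal.coe_le_coe, valuationOfIsNonarchimedean_apply]
    exact apply_ringOfIntegers_le_one hna b
  · rw [hP, ← NNReal.coe_lt_coe, valuationOfIsNonarchimedean_apply, NNReal.coe_one]

theorem apply_le_iff_of_center
    (hv : v.comp (algebraMap ℚ K).injective = Rat.AbsoluteValue.padic p)
    (hP : ∀ b : 𝓞 K, b ∈ P.asIdeal ↔ v (algebraMap (𝓞 K) K b) < 1)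
    (x y : K) : P.valuation K x ≤ P.valuation K y ↔ v x ≤ v y := by
  rw [(isEquiv_of_center hv hP).le_iff_le, ← NNReal.coe_le_coe,
    valuationOfIsNonarchimedean_apply, valuationOfIsNonarchimedean_apply]

theorem apply_eq_zpow_of_center
    (hv : v.comp (algebraMap ℚ K).injective = Rat.AbsoluteValue.padic p)
    (hP : ∀ b : 𝓞 K, b ∈ P.asIdeal ↔ v (algebraMap (𝓞 K) K b) < 1)
    {π : K} (hπ : P.valuation K π = WithZero.exp (-1 : ℤ)) {y : K}
    {n : ℤ} (hy : P.valuation K y = WithZero.exp (-n)) : v y = v π ^ n := by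
  have h := congrArg NNReal.toReal (eq_zpow_of_isEquiv P (isEquiv_of_center hv hP) hπ hy)
  rwa [NNReal.coe_zpow, valuationOfIsNonarchimedean_apply, valuationOfIsNonarchimedean_apply] at h

/-- The ramification index `e` of the center, as the order of `p` at `P`. -/
theorem exists_ramification_of_center
    (hv : v.comp (algebraMap ℚ K).injective = Rat.AbsoluteValue.padic p)
    (hP : ∀ b : 𝓞 K, b ∈ P.asIdeal ↔ v (algebraMap (𝓞 K) K b) < 1) :
    ∃ e : ℕ, e ≠ 0 ∧ P.valuation K (p : K) = WithZero.exp (-(e : ℤ)) := by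
  have hp0 : (p : 𝓞 K) ≠ 0 := by exact_mod_cast hp.out.ne_zero
  have hpval := valuation_natCast (K := K) P p
  have hval : P.valuation K (p : K) = WithZero.exp (-(multiplicity P.asIdeal
      (Ideal.span {(p : 𝓞 K)}) : ℤ)) := by
    rw [← P.intValuation_eq_exp_neg_multiplicity hp0]
    exact hpval
  refine ⟨_, fun h => ?_, hval⟩
  rw [h] at hval
  have h1 : (p : 𝓞 K) ∈ P.asIdeal := by
    rw [hP, map_natCast, apply_prime_of_padic hv]
    exact inv_lt_one_of_one_lt₀ (by exact_mod_cast hp.out.one_lt)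
  have h2 := (P.intValuation_lt_one_iff_mem _).2 h1
  rw [← hpval, hval] at h2
  simp at h2

/-- The residue ring `𝓞 K ⧸ P ^ e`, with `e` the ramification index, has `p ^ n_v` elements: it is
the unit ball of the completion modulo `p`, as `𝓞 K` is dense in the unit ball. -/
theorem card_quotient_of_center
    (hv : v.comp (algebraMap ℚ K).injective = Rat.AbsoluteValue.padic p)
    (hP : ∀ b : 𝓞 K, b ∈ P.asIdeal ↔ v (algebraMap (𝓞 K) K b) < 1)
    [IsUltrametricDist v.Completion] {e : ℕ}
    (he : P.valuation K (p : K) = WithZero.exp (-(e : ℤ))) :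
    Nat.card (𝓞 K ⧸ P.asIdeal ^ e) = p ^ Module.finrank
      ((algebraMap ℚ v.Completion).fieldRange.topologicalClosure) v.Completion := by
  have hna := isNonarchimedean_of_padic hv
  have hnorm := norm_algebraMap_completion v
  have hp0 : 0 < (p : ℝ)⁻¹ := inv_pos.2 (by exact_mod_cast hp.out.pos)
  have : Finite (𝓞 K ⧸ P.asIdeal ^ e) :=
    Ideal.finiteQuotientOfFreeOfNeBot _ (pow_ne_zero _ P.ne_bot)
  have hdense : ∀ x : v.Completion, ∃ y : K, ‖x - algebraMap K v.Completion y‖ < (p : ℝ)⁻¹ := by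
    intro x
    obtain ⟨y, hy⟩ := (UniformSpace.Completion.denseRange_coe (α := WithAbs v)).exists_dist_lt x hp0
    exact ⟨y.ofAbs, by rw [dist_eq_norm] at hy; exact hy⟩
  refine card_quotient_eq_pow_finrank _ (Subfield.isClosed_topologicalClosure _) ?_ ?_
    ((algebraMap K v.Completion).comp (algebraMap (𝓞 K) K)) ?_ ?_ _ ?_
  · rw [← map_natCast (algebraMap K v.Completion), hnorm, apply_prime_of_padic hv]
  · intro a ha ha1
    have ha' : a ∈ closure (Set.range (algebraMap ℚ v.Completion)) := ha
    obtain ⟨_, ⟨q, rfl⟩, hq⟩ := Metric.mem_closure_iff.1 ha' _ hp0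
    rw [dist_eq_norm] at hq
    have hpi : (p : ℝ)⁻¹ < 1 := inv_lt_one_of_one_lt₀ (by exact_mod_cast hp.out.one_lt)
    have hcast : ∀ r : ℚ, ‖algebraMap ℚ v.Completion r‖ = ‖(r : ℚ_[p])‖ := fun r => by
      rw [Padic.eq_padicNorm, ← apply_ratCast_of_padic hv, ← hnorm]
      congr 1
    have hq1 : ‖(q : ℚ_[p])‖ ≤ 1 := by
      rw [← hcast]
      have := norm_sub_le_max_norm a (a - algebraMap ℚ v.Completion q)
      rw [sub_sub_cancel] at this
      exact this.trans (max_le ha1 (hq.le.trans hpi.le))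
    obtain ⟨n, -, -, hn⟩ := PadicInt.exists_mem_range_of_norm_rat_le_one (p := p) q hq1
    refine ⟨n, ?_⟩
    have hn' : ‖((q - n : ℚ) : ℚ_[p])‖ ≤ (p : ℝ)⁻¹ := by
      have hn1 : ‖(q : ℚ_[p]) - (n : ℚ_[p])‖ < 1 := by
        have key : ∀ y : ℤ_[p], ‖y - (n : ℤ_[p])‖ < 1 → ‖(y : ℚ_[p]) - (n : ℚ_[p])‖ < 1 :=
          fun y h => by rwa [PadicInt.norm_def, PadicInt.coe_sub, PadicInt.coe_intCast] at h
        exact key _ hn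
      have h1 := (Padic.norm_le_pow_iff_norm_lt_pow_add_one ((q : ℚ_[p]) - (n : ℚ_[p])) (-1)).2
        (by simpa using hn1)
      simpa using h1
    rw [← hcast] at hn'
    have h3 := IsUltrametricDist.norm_add_le_max (a - algebraMap ℚ v.Completion q)
      (algebraMap ℚ v.Completion (q - n))
    rw [map_sub, map_intCast, sub_add_sub_cancel] at h3
    rw [map_sub, map_intCast] at hn'
    exact h3.trans (max_le hq.le hn')
  · exact fun b => (hnorm _).trans_le (apply_ringOfIntegers_le_one hna b)
  · intro x hx
    obtain ⟨y, hy⟩ := hdense x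
    have hy1 : v y ≤ v 1 := by
      rw [map_one, ← hnorm]
      have := norm_sub_le_max_norm x (x - algebraMap K v.Completion y)
      rw [sub_sub_cancel] at this
      exact this.trans (max_le hx (hy.le.trans
        (inv_le_one_of_one_le₀ (by exact_mod_cast hp.out.one_lt.le))))
    rw [← apply_le_iff_of_center hv hP, map_one] at hy1
    have hpne : P.valuation K (p : K) ≠ 0 := by rw [he]; exact WithZero.exp_ne_zero
    obtain ⟨b, hb⟩ := P.exists_valuation_sub_lt_of_integer hy1 (Units.mk0 _ hpne)
    refine ⟨b, ?_⟩
    have hb' := (apply_le_iff_of_center hv hP _ _).1 hb.le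
    rw [apply_prime_of_padic hv, ← hnorm, map_sub] at hb'
    have h3 := norm_sub_le_max_norm (x - algebraMap K v.Completion y)
      (algebraMap K v.Completion (algebraMap (𝓞 K) K b) - algebraMap K v.Completion y)
    rw [sub_sub_sub_cancel_right] at h3
    exact h3.trans (max_le hy.le hb')
  · intro b
    rw [← P.intValuation_le_pow_iff_mem, ← P.valuation_of_algebraMap (K := K), ← he,
      apply_le_iff_of_center hv hP, apply_prime_of_padic hv, RingHom.comp_apply, hnorm]

theorem adicAbv_eq_zpow {x : K} {n : ℤ} (hx : P.valuation K x = WithZero.exp (-n)) :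
    HeightOneSpectrum.adicAbv K P x = (Ideal.absNorm P.asIdeal : ℝ) ^ (-n) := by
  rw [HeightOneSpectrum.adicAbv_def, hx, toNNReal_exp, NNReal.coe_zpow, NNReal.coe_natCast]

/-- The normalized absolute value of a prime is the power of `|·|_v` by the local degree. -/
theorem pow_finrank_of_center
    (hv : v.comp (algebraMap ℚ K).injective = Rat.AbsoluteValue.padic p)
    (hP : ∀ b : 𝓞 K, b ∈ P.asIdeal ↔ v (algebraMap (𝓞 K) K b) < 1)
    (x : K) :
    v x ^ Module.finrank
      ((algebraMap ℚ v.Completion).fieldRange.topologicalClosure) v.Completion =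
      HeightOneSpectrum.adicAbv K P x := by
  have := isUltrametricDist_completion (isNonarchimedean_of_padic hv)
  obtain ⟨e, he0, he⟩ := exists_ramification_of_center hv hP
  have hcard := card_quotient_of_center hv hP he
  set m := Module.finrank
    ((algebraMap ℚ v.Completion).fieldRange.topologicalClosure) v.Completion
  set N := Ideal.absNorm P.asIdeal with hN
  rw [← Submodule.cardQuot_apply, ← Ideal.absNorm_apply, map_pow, ← hN] at hcard
  have hN1 : 1 < N := HeightOneSpectrum.one_lt_absNorm P
  have hm : m ≠ 0 := fun h => by
    rw [h, pow_zero] at hcard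
    exact (Nat.one_lt_pow he0 hN1).ne' hcard
  by_cases hx : x = 0
  · simp [hx, hm]
  obtain ⟨π, hπ⟩ := P.valuation_exists_uniformizer K
  obtain ⟨n, hn⟩ := exists_valuation_eq_exp_neg P hx
  have hπe : v π ^ e = (p : ℝ)⁻¹ := by
    rw [← apply_prime_of_padic hv, ← zpow_natCast]
    exact (apply_eq_zpow_of_center hv hP hπ he).symm
  have hπm : v π ^ m = (N : ℝ)⁻¹ := by
    refine (pow_left_inj₀ (pow_nonneg (v.nonneg _) _) (by positivity) he0).1 ?_
    rw [← pow_mul, mul_comm, pow_mul, hπe, inv_pow, inv_pow]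
    exact_mod_cast congrArg (fun t : ℕ => ((t : ℝ))⁻¹) hcard.symm
  rw [apply_eq_zpow_of_center hv hP hπ hn, adicAbv_eq_zpow hn, ← hN, ← zpow_natCast, ← zpow_mul,
    mul_comm, zpow_mul, zpow_natCast, hπm, inv_zpow, zpow_neg]

end Center

end NumberFieldPlace

/-! ### The product formula for number fields -/

theorem finsum_sum_type {α β : Type*} {M : Type*} [AddCommMonoid M] (f : α ⊕ β → M)
    (hf : (Function.support f).Finite) :
    ∑ᶠ s, f s = (∑ᶠ a, f (.inl a)) + ∑ᶠ b, f (.inr b) := by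
  rw [← finsum_mem_univ, ← Set.range_inl_union_range_inr,
    finsum_mem_union' Set.isCompl_range_inl_range_inr.disjoint (hf.inter_of_right _)
      (hf.inter_of_right _), finsum_mem_range Sum.inl_injective, finsum_mem_range Sum.inr_injective]

namespace NumberFieldPlace

open NumberField IsDedekindDomain

variable {K : Type*} [Field K] [NumberField K]

/-- Correspondence between places as absolute values of `K` and Mathlib's infinite places and
primes. -/
def Corresponds (v : NumberFieldPlace K) : InfinitePlace K ⊕ HeightOneSpectrum (𝓞 K) → Prop
  | .inl w => w.1 = v.1
  | .inr P => (∃ (p : ℕ) (_ : Fact p.Prime),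
      v.1.comp (algebraMap ℚ K).injective = Rat.AbsoluteValue.padic p) ∧
      ∀ b : 𝓞 K, b ∈ P.asIdeal ↔ v.1 (algebraMap (𝓞 K) K b) < 1

theorem exists_corresponds (v : NumberFieldPlace K) : ∃ s, Corresponds v s := by
  rcases v.2 with h | ⟨p, hp, h⟩
  · obtain ⟨w, hw, -⟩ := exists_infinitePlace v h
    exact ⟨.inl w, hw⟩
  · obtain ⟨P, hP⟩ := exists_center h
    exact ⟨.inr P, ⟨p, hp, h⟩, hP⟩

/-- Ostrowski's theorem for a bounded absolute value, with the normalization at `p`. -/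
theorem eq_padic_of_le_one {f : AbsoluteValue ℚ ℝ} (hf : ∀ n : ℕ, f n ≤ 1) {p : ℕ}
    [hp : Fact p.Prime] (hfp : f p = (p : ℝ)⁻¹) : f = Rat.AbsoluteValue.padic p := by
  have hp1 : (1 : ℝ) < p := by exact_mod_cast hp.out.one_lt
  have hnt : f.IsNontrivial := ⟨p, by exact_mod_cast hp.out.ne_zero, by
    rw [hfp]; exact (inv_lt_one_of_one_lt₀ hp1).ne⟩
  obtain ⟨q, ⟨hq, hfq⟩, -⟩ := Rat.AbsoluteValue.equiv_padic_of_bounded hnt hf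
  obtain ⟨c, hc, h⟩ := AbsoluteValue.isEquiv_iff_exists_rpow_eq.1 hfq
  have hqp : q = p := by
    by_contra hne
    have h1 := congrFun h p
    rw [Rat.AbsoluteValue.padic_eq_padicNorm, hfp,
      padicNorm.padicNorm_of_prime_of_ne hne, Rat.cast_one] at h1
    exact (Real.rpow_lt_one (by positivity) (inv_lt_one_of_one_lt₀ hp1) hc).ne h1
  subst hqp
  have h1 := congrFun h q
  rw [Rat.AbsoluteValue.padic_eq_padicNorm, hfp, padicNorm.padicNorm_p hp.out.one_lt] at h1
  have hc1 : c = 1 := by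
    have h2 : ((q : ℝ)⁻¹) ^ c = ((q : ℝ)⁻¹) ^ (1 : ℝ) := by rw [h1]; simp
    have hq0 : (0 : ℝ) < (q : ℝ)⁻¹ := by positivity
    have h3 := congrArg Real.log h2
    rw [Real.log_rpow hq0, Real.log_rpow hq0] at h3
    exact mul_right_cancel₀ (Real.log_neg hq0 (inv_lt_one_of_one_lt₀ hp1)).ne h3
  ext x
  have := congrFun h x
  simpa [hc1] using this

/-- Every prime is the center of a place: rescale the `P`-adic absolute value so that it extends a
`p`-adic one. -/
theorem exists_place_of_prime (P : HeightOneSpectrum (𝓞 K)) :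
    ∃ v : NumberFieldPlace K, Corresponds v (.inr P) := by
  have : Finite (𝓞 K ⧸ P.asIdeal) := Ideal.finiteQuotientOfFreeOfNeBot _ P.ne_bot
  have : P.asIdeal.IsPrime := P.isPrime
  obtain ⟨p, hpc⟩ := CharP.exists (𝓞 K ⧸ P.asIdeal)
  have hp : Fact p.Prime := ⟨CharP.char_is_prime (𝓞 K ⧸ P.asIdeal) p⟩
  have hpP : (p : 𝓞 K) ∈ P.asIdeal := by
    rw [← Ideal.Quotient.eq_zero_iff_mem, map_natCast]
    exact CharP.cast_eq_zero _ p
  have hp1 : (1 : ℝ) < p := by exact_mod_cast hp.out.one_lt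
  have hpval := valuation_natCast (K := K) P p
  obtain ⟨n, hn⟩ := exists_valuation_eq_exp_neg (K := K) P
    (y := (p : K)) (by exact_mod_cast hp.out.ne_zero)
  have hn0 : 0 < n := by
    have h := (P.intValuation_lt_one_iff_mem _).2 hpP
    rw [← hpval, hn, ← WithZero.exp_zero, WithZero.exp_lt_exp] at h
    omega
  -- the base `p ^ (1 / n)` normalizes the absolute value of `p` to `1 / p`
  set β : NNReal := (p : NNReal) ^ ((n : ℝ)⁻¹) with hβ
  have hβ1 : 1 < β := NNReal.one_lt_rpow (by exact_mod_cast hp.out.one_lt)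
    (inv_pos.2 (by exact_mod_cast hn0))
  have hmem : ∀ b : 𝓞 K, b ∈ P.asIdeal ↔ P.adicAbv (K := K) hβ1 (algebraMap (𝓞 K) K b) < 1 :=
    fun b => (P.adicAbv_coe_lt_one_iff hβ1 b).symm
  have hpadic : (P.adicAbv (K := K) hβ1).comp (algebraMap ℚ K).injective =
      Rat.AbsoluteValue.padic p := by
    apply eq_padic_of_le_one
    · intro m
      change P.adicAbv (K := K) hβ1 (algebraMap ℚ K m) ≤ 1
      have := P.adicAbv_coe_le_one (K := K) hβ1 (m : 𝓞 K)
      rwa [map_natCast] at this ⊢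
    · change P.adicAbv (K := K) hβ1 (algebraMap ℚ K p) = _
      rw [map_natCast]
      change ((WithZeroMulInt.toNNReal (zero_lt_one.trans hβ1).ne' (P.valuation K (p : K)) :
        NNReal) : ℝ) = _
      rw [hn, toNNReal_exp]
      rw [NNReal.coe_zpow, hβ, NNReal.coe_rpow, NNReal.coe_natCast, ← Real.rpow_intCast,
        ← Real.rpow_mul (by positivity)]
      have : (n : ℝ) ≠ 0 := by exact_mod_cast hn0.ne'
      push_cast
      rw [mul_neg, inv_mul_cancel₀ this, Real.rpow_neg_one]
  exact ⟨⟨P.adicAbv hβ1, Or.inr ⟨p, hp, hpadic⟩⟩, ⟨p, hp, hpadic⟩, hmem⟩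

theorem exists_place (s : InfinitePlace K ⊕ HeightOneSpectrum (𝓞 K)) :
    ∃ v : NumberFieldPlace K, Corresponds v s := by
  rcases s with w | P
  · exact ⟨⟨w.1, Or.inl (infinitePlace_comp_rat w)⟩, rfl⟩
  · exact exists_place_of_prime P

theorem real_ne_padic (p : ℕ) [Fact p.Prime] :
    Rat.AbsoluteValue.real ≠ Rat.AbsoluteValue.padic p := fun h =>
  Rat.AbsoluteValue.not_real_isEquiv_padic p (h ▸ AbsoluteValue.IsEquiv.refl _)

theorem Corresponds.right_unique {v : NumberFieldPlace K}
    {s t : InfinitePlace K ⊕ HeightOneSpectrum (𝓞 K)} (hs : Corresponds v s)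
    (ht : Corresponds v t) : s = t := by
  have hne : ∀ (w : InfinitePlace K) (P : HeightOneSpectrum (𝓞 K)),
      Corresponds v (.inl w) → ¬ Corresponds v (.inr P) := by
    rintro w P (hw : w.1 = v.1) ⟨⟨p, hp, h⟩, -⟩
    have h2 := infinitePlace_comp_rat w
    simp only [hw] at h2
    exact real_ne_padic p (h2.symm.trans h)
  rcases s with w | P <;> rcases t with w' | P'
  · exact congrArg Sum.inl (Subtype.ext ((show w.1 = v.1 from hs).trans
      (show w'.1 = v.1 from ht).symm))
  · exact (hne w P' hs ht).elim
  · exact (hne w' P ht hs).elim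
  · exact congrArg Sum.inr (HeightOneSpectrum.ext (Ideal.ext fun b =>
      (hs.2 b).trans (ht.2 b).symm))

/-- A place with center `P` is determined by its value at a uniformizer, which is fixed by the
normalization `|p| = p⁻¹`. -/
theorem Corresponds.left_unique {v v' : NumberFieldPlace K}
    {s : InfinitePlace K ⊕ HeightOneSpectrum (𝓞 K)} (h : Corresponds v s)
    (h' : Corresponds v' s) : v = v' := by
  rcases s with w | P
  · exact Subtype.ext ((show w.1 = v.1 from h).symm.trans h')
  obtain ⟨⟨p, hp, hv⟩, hP⟩ := h
  obtain ⟨⟨p', hp', hv'⟩, hP'⟩ := h'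
  have hpp : p = p' := by
    by_contra hne
    have h1 : (p : 𝓞 K) ∈ P.asIdeal := by
      rw [hP, map_natCast, apply_prime_of_padic hv]
      exact inv_lt_one_of_one_lt₀ (by exact_mod_cast hp.out.one_lt)
    rw [hP', map_natCast, ← Rat.cast_natCast, apply_ratCast_of_padic hv',
      padicNorm.padicNorm_of_prime_of_ne (Ne.symm hne)] at h1
    simp at h1
  subst hpp
  obtain ⟨e, he0, he⟩ := exists_ramification_of_center hv hP
  obtain ⟨π, hπ⟩ := P.valuation_exists_uniformizer K
  have hππ : v.1 π = v'.1 π := by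
    refine (pow_left_inj₀ (v.1.nonneg _) (v'.1.nonneg _) he0).1 ?_
    rw [← zpow_natCast, ← zpow_natCast, ← apply_eq_zpow_of_center hv hP hπ he,
      ← apply_eq_zpow_of_center hv' hP' hπ he, apply_prime_of_padic hv, apply_prime_of_padic hv']
  refine Subtype.ext (AbsoluteValue.ext fun x => ?_)
  by_cases hx : x = 0
  · simp [hx]
  obtain ⟨n, hn⟩ := exists_valuation_eq_exp_neg P hx
  rw [apply_eq_zpow_of_center hv hP hπ hn, apply_eq_zpow_of_center hv' hP' hπ hn, hππ]

/-- The contribution of a place to the product formula, in terms of Mathlib's places. -/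
noncomputable def logTerm (x : K) : InfinitePlace K ⊕ HeightOneSpectrum (𝓞 K) → ℝ
  | .inl w => w.mult * Real.log (w x)
  | .inr P => Real.log (HeightOneSpectrum.adicAbv K P x)

theorem Corresponds.localDegree_mul_log {v : NumberFieldPlace K}
    {s : InfinitePlace K ⊕ HeightOneSpectrum (𝓞 K)} (h : Corresponds v s) (x : K) :
    (v.localDegree : ℝ) * Real.log (v.1 x) = logTerm x s := by
  rcases s with w | P
  · have hw : w.1 = v.1 := h
    have hv := infinitePlace_comp_rat w
    simp only [hw] at hv
    obtain ⟨w', hw', hdeg⟩ := exists_infinitePlace v hv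
    obtain rfl : w' = w := Subtype.ext (hw'.trans hw.symm)
    rw [logTerm, hdeg, ← hw]
    rfl
  · obtain ⟨⟨p, hp, hv⟩, hP⟩ := h
    rw [logTerm, ← pow_finrank_of_center hv hP, Real.log_pow]
    rfl

theorem finitePlace_symm_apply (P : HeightOneSpectrum (𝓞 K)) (x : K) :
    FinitePlace.equivHeightOneSpectrum.symm P x = HeightOneSpectrum.adicAbv K P x :=
  FinitePlace.norm_embedding P x

theorem finite_adicAbv_ne_one {x : K} (hx : x ≠ 0) :
    {P : HeightOneSpectrum (𝓞 K) | HeightOneSpectrum.adicAbv K P x ≠ 1}.Finite := by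
  refine ((FinitePlace.hasFiniteMulSupport hx).image FinitePlace.equivHeightOneSpectrum).subset
    fun P hP => ⟨FinitePlace.equivHeightOneSpectrum.symm P, ?_, by simp⟩
  rw [Function.mem_mulSupport, finitePlace_symm_apply]
  exact hP

theorem finsum_logTerm {x : K} (hx : x ≠ 0) : ∑ᶠ s, logTerm x s = 0 := by
  have hfin : (Function.support (logTerm x)).Finite := by
    refine ((Set.finite_range Sum.inl).union ((finite_adicAbv_ne_one hx).image Sum.inr)).subset ?_
    rintro (w | P) hs
    · exact Or.inl ⟨w, rfl⟩
    · refine Or.inr ⟨P, fun h => hs ?_, rfl⟩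
      rw [logTerm, h, Real.log_one]
  have hpos : ∀ w : FinitePlace K, 0 < w x := fun w => FinitePlace.pos_iff.2 hx
  have hinf : ∀ w : InfinitePlace K, 0 < w x := fun w => InfinitePlace.pos_iff.2 hx
  have h1 := NumberField.prod_abs_eq_one hx
  have h := congrArg Real.log h1
  rw [Real.log_mul (Finset.prod_pos fun w _ => pow_pos (hinf w) _).ne'
      (right_ne_zero_of_mul (h1 ▸ one_ne_zero)),
    Real.log_prod fun w _ => (pow_pos (hinf w) _).ne', Real.log_finprod hpos, Real.log_one] at h
  rw [finsum_sum_type _ hfin, ← h, finsum_eq_sum_of_fintype]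
  congr 1
  · exact Finset.sum_congr rfl fun w _ => by rw [logTerm, Real.log_pow]
  · refine finsum_eq_of_bijective _ FinitePlace.equivHeightOneSpectrum.symm.bijective fun P => ?_
    rw [finitePlace_symm_apply, logTerm]

theorem exists_equiv :
    ∃ e : NumberFieldPlace K → InfinitePlace K ⊕ HeightOneSpectrum (𝓞 K),
      Function.Bijective e ∧ ∀ v, Corresponds v (e v) := by
  choose e he using exists_corresponds (K := K)
  refine ⟨e, ⟨fun v v' h => (he v).left_unique (h ▸ he v'), fun s => ?_⟩, he⟩
  obtain ⟨v, hv⟩ := exists_place s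
  exact ⟨v, (he v).right_unique hv⟩

theorem product_formula {x : K} (hx : x ≠ 0) :
    ∑ᶠ v : NumberFieldPlace K, (v.localDegree : ℝ) * Real.log (v.1 x) = 0 := by
  obtain ⟨e, he, hc⟩ := exists_equiv (K := K)
  rw [finsum_eq_of_bijective e he fun v => (hc v).localDegree_mul_log x, finsum_logTerm hx]

theorem finite_ne_one {x : K} (hx : x ≠ 0) : {v : NumberFieldPlace K | v.1 x ≠ 1}.Finite := by
  obtain ⟨e, he, hc⟩ := exists_equiv (K := K)
  refine (((Set.finite_range Sum.inl).union ((finite_adicAbv_ne_one hx).image Sum.inr)).preimage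
    he.1.injOn).subset fun v hv => ?_
  have h := hc v
  rw [Set.mem_preimage]
  generalize e v = s at h ⊢
  rcases s with w | P
  · exact Or.inl ⟨w, rfl⟩
  · obtain ⟨⟨p, hp, hvp⟩, hP⟩ := h
    refine Or.inr ⟨P, fun h1 => hv ?_, rfl⟩
    obtain ⟨n, hn⟩ := exists_valuation_eq_exp_neg P hx
    obtain ⟨π, hπ⟩ := P.valuation_exists_uniformizer K
    rw [adicAbv_eq_zpow hn, zpow_eq_one_iff_right₀ (by positivity)
      (by exact_mod_cast (HeightOneSpectrum.one_lt_absNorm P).ne'), neg_eq_zero] at h1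
    rw [apply_eq_zpow_of_center hvp hP hπ hn, h1, zpow_zero]

theorem finite_not_isNonarchimedean :
    {v : NumberFieldPlace K | ¬ IsNonarchimedean v.1}.Finite := by
  obtain ⟨e, he, hc⟩ := exists_equiv (K := K)
  refine ((Set.finite_range Sum.inl).preimage he.1.injOn).subset fun v hv => ?_
  have h := hc v
  rw [Set.mem_preimage]
  generalize e v = s at h ⊢
  rcases s with w | P
  · exact ⟨w, rfl⟩
  · obtain ⟨⟨p, hp, hvp⟩, hP⟩ := h
    exact (hv (isNonarchimedean_of_padic hvp)).elim

end NumberFieldPlace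

/-! ### Separating elements of a function field -/

section Separating

open KaehlerDifferential IntermediateField

variable {k K : Type*} [Field k] [Field K] [Algebra k K]

/-- A `k`-derivation that kills `t` kills `k(t)`, so it vanishes when `K / k(t)` is finite
separable. -/
theorem derivation_eq_zero_of_isSeparable {M : Type*} [AddCommGroup M] [Module k M] [Module K M]
    [IsScalarTower k K M] (D : Derivation k K M) {t : K} (ht : D t = 0)
    [FiniteDimensional k⟮t⟯ K] [Algebra.IsSeparable k⟮t⟯ K] : D = 0 := by
  let E : IntermediateField k K :=
    { carrier := {a | D a = 0}
      mul_mem' := fun {a b} ha hb => by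
        simp only [Set.mem_ofPred_eq] at *
        rw [D.leibniz, ha, hb, smul_zero, smul_zero, add_zero]
      add_mem' := fun {a b} ha hb => by
        simp only [Set.mem_ofPred_eq] at *
        rw [map_add, ha, hb, add_zero]
      algebraMap_mem' := fun c => D.map_algebraMap c
      inv_mem' := fun a ha => by
        simp only [Set.mem_ofPred_eq] at *
        rw [D.leibniz_inv, ha, smul_zero] }
  have hE : k⟮t⟯ ≤ E := adjoin_simple_le_iff.2 ht
  have hsmul : ∀ (c : k⟮t⟯) (m : M), c • m = (c : K) • m := fun _ _ => rfl
  let D' : Derivation k⟮t⟯ K M :=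
    { toFun := D
      map_add' := map_add D
      map_smul' := fun c a => by
        have hc : D (c : K) = 0 := hE c.2
        rw [RingHom.id_apply, Algebra.smul_def, hsmul]
        change D ((c : K) * a) = _
        rw [D.leibniz, hc, smul_zero, add_zero]
      map_one_eq_zero' := D.map_one_eq_zero
      leibniz' := D.leibniz }
  have hunr : Algebra.FormallyUnramified k⟮t⟯ K :=
    (Algebra.FormallyUnramified.iff_isSeparable _ _).2 inferInstance
  have hsub : Subsingleton Ω[K⁄k⟮t⟯] := hunr.subsingleton_kaehlerDifferential
  ext a
  have h := D'.liftKaehlerDifferential_comp_D a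
  rw [Subsingleton.elim (KaehlerDifferential.D k⟮t⟯ K a) 0, map_zero] at h
  exact h.symm

theorem essFiniteType_of_finiteDimensional (t : K) [FiniteDimensional k⟮t⟯ K] :
    Algebra.EssFiniteType k K := by
  have : Algebra.EssFiniteType k k⟮t⟯ :=
    essFiniteType_iff.2 ⟨{t}, by simp⟩
  exact .comp k k⟮t⟯ K

/-- The differential of a separating element spans the Kähler differentials. -/
theorem span_D_eq_top (t : K) [FiniteDimensional k⟮t⟯ K] [Algebra.IsSeparable k⟮t⟯ K] :
    Submodule.span K {KaehlerDifferential.D k K t} = ⊤ := by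
  set N := Submodule.span K {KaehlerDifferential.D k K t} with hN
  have h := derivation_eq_zero_of_isSeparable (t := t)
    (N.mkQ.compDer (KaehlerDifferential.D k K))
    ((Submodule.Quotient.mk_eq_zero N).2 (Submodule.mem_span_singleton_self _))
  rw [eq_top_iff, ← KaehlerDifferential.span_range_derivation, Submodule.span_le]
  rintro _ ⟨a, rfl⟩
  exact (Submodule.Quotient.mk_eq_zero N).1 (congrArg (fun D => D a) h)

theorem D_ne_zero_of_transcendental {t : K} (ht : Transcendental k t) [FiniteDimensional k⟮t⟯ K]
    [Algebra.IsSeparable k⟮t⟯ K] : KaehlerDifferential.D k K t ≠ 0 := by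
  intro h
  have hspan := span_D_eq_top (k := k) t
  rw [h, Submodule.span_zero_singleton] at hspan
  have : Subsingleton Ω[K⁄k] := (Submodule.subsingleton_iff K).1
    (subsingleton_of_bot_eq_top hspan)
  have := essFiniteType_of_finiteDimensional (k := k) t
  have : Algebra.IsSeparable k K :=
    (Algebra.FormallyUnramified.iff_isSeparable _ _).1 ⟨inferInstance⟩
  exact ht (Algebra.IsAlgebraic.isAlgebraic t)

/-- An element with nonzero differential is a separating element. -/
theorem isSeparable_of_D_ne_zero {t : K} [FiniteDimensional k⟮t⟯ K]
    [Algebra.IsSeparable k⟮t⟯ K] {u : K} (hu : KaehlerDifferential.D k K u ≠ 0) :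
    FiniteDimensional k⟮u⟯ K ∧ Algebra.IsSeparable k⟮u⟯ K := by
  have := essFiniteType_of_finiteDimensional (k := k) t
  have hess : Algebra.EssFiniteType k⟮u⟯ K := .of_comp k _ _
  have hspan : Submodule.span K {KaehlerDifferential.D k K u} = ⊤ := by
    obtain ⟨c, hc⟩ := Submodule.mem_span_singleton.1
      ((span_D_eq_top (k := k) t).symm ▸ Submodule.mem_top :
        KaehlerDifferential.D k K u ∈ Submodule.span K {KaehlerDifferential.D k K t})
    have hc0 : c ≠ 0 := fun h => hu (by rw [← hc, h, zero_smul])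
    rw [← hc, Submodule.span_singleton_smul_eq hc0.isUnit, span_D_eq_top]
  have hzero : ∀ a : K, KaehlerDifferential.D k⟮u⟯ K a = 0 := by
    intro a
    let f := KaehlerDifferential.map k k⟮u⟯ K K
    have hf : ∀ b, f (KaehlerDifferential.D k K b) = KaehlerDifferential.D k⟮u⟯ K b := fun b => by
      simp [f]
    obtain ⟨c, hc⟩ := Submodule.mem_span_singleton.1
      (hspan.symm ▸ Submodule.mem_top :
        KaehlerDifferential.D k K a ∈ Submodule.span K {KaehlerDifferential.D k K u})
    have hu0 : KaehlerDifferential.D k⟮u⟯ K u = 0 :=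
      (KaehlerDifferential.D k⟮u⟯ K).map_algebraMap (AdjoinSimple.gen k u)
    rw [← hf, ← hc, map_smul, hf, hu0, smul_zero]
  have : Subsingleton Ω[K⁄k⟮u⟯] := by
    refine (Submodule.subsingleton_iff K).1 (subsingleton_of_bot_eq_top ?_)
    rw [← KaehlerDifferential.span_range_derivation, eq_comm, Submodule.span_eq_bot]
    rintro _ ⟨a, rfl⟩
    exact hzero a
  have hunr : Algebra.FormallyUnramified k⟮u⟯ K := ⟨inferInstance⟩
  exact ⟨Algebra.FormallyUnramified.finite_of_free _ _,
    (Algebra.FormallyUnramified.iff_isSeparable _ _).1 hunr⟩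

/-- Over a perfect field, an algebraic element satisfies a separable polynomial, so its differential
vanishes. -/
theorem transcendental_of_D_ne_zero [PerfectField k] {u : K}
    (hu : KaehlerDifferential.D k K u ≠ 0) : Transcendental k u := by
  intro h
  have hsep : IsSeparable k u :=
    PerfectField.separable_of_irreducible (minpoly.irreducible h.isIntegral)
  have h0 := congrArg (KaehlerDifferential.D k K) (minpoly.aeval k u)
  rw [map_zero, Derivation.map_aeval] at h0
  exact (smul_ne_zero (hsep.aeval_derivative_ne_zero (minpoly.aeval k u)) hu) h0

/-- Every nonzero element is a quotient of two separating elements. -/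
theorem exists_separating_quotient {t : K} (ht : Transcendental k t) [FiniteDimensional k⟮t⟯ K]
    [Algebra.IsSeparable k⟮t⟯ K] {x : K} (hx : x ≠ 0) :
    KaehlerDifferential.D k K x ≠ 0 ∨ ∃ y z : K, KaehlerDifferential.D k K y ≠ 0 ∧
      KaehlerDifferential.D k K z ≠ 0 ∧ y = x * z ∧ z ≠ 0 := by
  by_cases h : KaehlerDifferential.D k K x = 0
  · have hDt := D_ne_zero_of_transcendental ht
    refine Or.inr ⟨x * t, t, ?_, hDt, rfl, fun h0 => hDt (by rw [h0, map_zero])⟩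
    rw [Derivation.leibniz, h, smul_zero, add_zero]
    exact smul_ne_zero hx hDt
  · exact Or.inl h

end Separating

/-! ### Places of a function field above a prime of a polynomial ring -/

namespace FunctionFieldPlace

open IsDedekindDomain

variable {K : Type*} [Field K] {k : Subfield K}

@[ext]
theorem ext {v w : FunctionFieldPlace k} (h : v.val = w.val) : v = w := by
  cases v; cases w; cases h; rfl

theorem val_constant_le_one (v : FunctionFieldPlace k) (a : k) : v.val (a : K) ≤ 1 := by
  by_cases h : (a : K) = 0
  · simp [h]
  · exact (v.trivial_on_constants a a.2 h).le

theorem val_le_one_of_isIntegral (v : FunctionFieldPlace k) {R : Type*} [CommRing R] [Algebra R K]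
    (hR : ∀ r : R, v.val (algebraMap R K r) ≤ 1) {y : K} (hy : IsIntegral R y) : v.val y ≤ 1 := by
  have h : IsIntegral v.val.integer y := by
    obtain ⟨f, hf, hfy⟩ := hy
    let g : R →+* v.val.integer := (algebraMap R K).codRestrict v.val.integer hR
    refine ⟨f.map g, hf.map g, ?_⟩
    rw [Polynomial.eval₂_map]
    exact hfy
  exact (Valuation.integer.integers v.val).mem_of_integral h

/-- Two valuations onto `ℤᵐ⁰` that are equivalent coincide. -/
theorem val_eq_valuation {B : Type*} [CommRing B] [IsDedekindDomain B] [Algebra B K]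
    [IsFractionRing B K] (v : FunctionFieldPlace k) {P : HeightOneSpectrum B}
    (hP : (P.valuation K).IsEquiv v.val) : v.val = P.valuation K := by
  obtain ⟨π, hπ⟩ := P.valuation_exists_uniformizer K
  have hπ0 : v.val π ≠ 0 := by
    rw [Valuation.ne_zero_iff]
    rintro rfl
    exact WithZero.exp_ne_zero (by rw [← hπ, map_zero])
  obtain ⟨y, hy⟩ := v.surjective (WithZero.exp (-1 : ℤ))
  have hy0 : y ≠ 0 := by
    rintro rfl
    exact WithZero.exp_ne_zero (by rw [← hy, map_zero])
  obtain ⟨n, hn⟩ := exists_valuation_eq_exp_neg P hy0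
  have h1 := eq_zpow_of_isEquiv P hP hπ hn
  obtain ⟨m, hm⟩ : ∃ m : ℤ, v.val π = WithZero.exp m := ⟨_, (WithZero.exp_log hπ0).symm⟩
  have hm0 : m < 0 := by
    have := hP.lt_one_iff_lt_one.1 (show P.valuation K π < 1 by
      rw [hπ, ← WithZero.exp_zero, WithZero.exp_lt_exp]; omega)
    rwa [hm, ← WithZero.exp_zero, WithZero.exp_lt_exp] at this
  have hm1 : m = -1 := by
    rw [hy, hm, ← WithZero.exp_zsmul, WithZero.exp_inj, smul_eq_mul] at h1
    have hu : m ∣ 1 := ⟨-n, by linarith [mul_comm n m, mul_neg m n]⟩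
    rcases Int.isUnit_iff.1 (isUnit_of_dvd_one hu) with h | h <;> omega
  ext x
  by_cases hx : x = 0
  · simp [hx]
  obtain ⟨n, hn⟩ := exists_valuation_eq_exp_neg P hx
  rw [eq_zpow_of_isEquiv P hP hπ hn, hn, hm, hm1, ← WithZero.exp_zsmul]
  simp

section Fiber

variable {B : Type*} [CommRing B] [IsDedekindDomain B] [Algebra B K] [IsFractionRing B K]
  [Algebra k B] [IsScalarTower k B K]

variable (k) in
/-- The place of a function field defined by a prime of a Dedekind model. -/
noncomputable def ofPrime (P : HeightOneSpectrum B) : FunctionFieldPlace k where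
  val := P.valuation K
  surjective := P.valuation_surjective K
  trivial_on_constants a ha ha0 := by
    have hle : ∀ c : k, P.valuation K (c : K) ≤ 1 := fun c => by
      rw [show (c : K) = algebraMap B K (algebraMap k B c) from
        IsScalarTower.algebraMap_apply k B K c]
      exact P.valuation_le_one _
    refine (hle ⟨a, ha⟩).antisymm ?_
    have h := hle ⟨a⁻¹, k.inv_mem ha⟩
    rw [map_inv₀] at h
    exact (inv_le_one₀ (zero_lt_iff.2 ((Valuation.ne_zero_iff _).2 ha0))).1 h

theorem ofPrime_injective : Function.Injective (ofPrime (B := B) k) := by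
  intro P Q h
  refine HeightOneSpectrum.ext (Ideal.ext fun b => ?_)
  have hval : P.valuation K = Q.valuation K := congrArg FunctionFieldPlace.val h
  rw [← P.valuation_lt_one_iff_mem (K := K), hval, Q.valuation_lt_one_iff_mem]

/-- The residue field of the place of a prime `P` is a quotient of `B`. -/
theorem residue_surjective (P : HeightOneSpectrum B)
    (z : IsLocalRing.ResidueField (ofPrime k P).val.valuationSubring) :
    ∃ b : B, IsLocalRing.residue _ (⟨algebraMap B K b, P.valuation_le_one b⟩ :
      (ofPrime k P).val.valuationSubring) = z := by
  obtain ⟨⟨z, hz⟩, rfl⟩ := IsLocalRing.residue_surjective z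
  obtain ⟨n, d, h⟩ := P.exists_primeCompl_mul_eq_of_integer z hz
  have hd : (d : B) ∉ P.asIdeal := d.2
  obtain ⟨d', i, hi, hd'⟩ := P.isMaximal.exists_inv hd
  refine ⟨n * d', ?_⟩
  rw [← sub_eq_zero, ← map_sub, IsLocalRing.residue_eq_zero_iff, Valuation.mem_maximalIdeal_iff]
  have hdiff : algebraMap B K (n * d') - z = -(z * algebraMap B K i) := by
    rw [map_mul, ← h, eq_sub_of_add_eq' hd']
    push_cast [map_sub, map_mul, map_one]
    ring
  change P.valuation K (algebraMap B K (n * d') - z) < 1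
  rw [hdiff, Valuation.map_neg, map_mul]
  exact (mul_le_of_le_one_left' hz).trans_lt ((P.valuation_lt_one_iff_mem i).2 hi)

/-- The degree of the place of a prime `P` is the degree of `B ⧸ P` over the constants. -/
theorem degree_ofPrime (P : HeightOneSpectrum B) :
    (ofPrime k P).degree = Module.finrank k (B ⧸ P.asIdeal) := by
  let A := (ofPrime k P).val.valuationSubring
  let g : B →+* A := (algebraMap B K).codRestrict A.toSubring fun b => P.valuation_le_one b
  let f : B →+* IsLocalRing.ResidueField A := (IsLocalRing.residue A).comp g
  have hf : Function.Surjective f := residue_surjective P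
  have hker : RingHom.ker f = P.asIdeal := by
    ext b
    rw [RingHom.mem_ker, RingHom.comp_apply, IsLocalRing.residue_eq_zero_iff,
      ← P.valuation_lt_one_iff_mem (K := K)]
    exact Valuation.mem_maximalIdeal_iff _ _
  let e₁ : (B ⧸ P.asIdeal) ≃+* IsLocalRing.ResidueField A :=
    (Ideal.quotEquivOfEq hker.symm).trans (RingHom.quotientKerEquivOfSurjective hf)
  let e₀ : k ≃+* (ofPrime k P).constantsToResidue.fieldRange :=
    RingEquiv.ofBijective (ofPrime k P).constantsToResidue.rangeRestrictField
      ⟨(ofPrime k P).constantsToResidue.rangeRestrictField.injective,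
        fun ⟨_, a, h⟩ => ⟨a, Subtype.ext h⟩⟩
  refine (Algebra.finrank_eq_of_equiv_equiv e₀ e₁ ?_).symm
  ext a
  exact congrArg (IsLocalRing.residue A) (Subtype.ext (IsScalarTower.algebraMap_apply k B K a))

/-- A place that is finite on `R` and at which `ϖ` is small is the place of a prime of `B`
above `ϖ`. -/
theorem exists_ofPrime_eq (v : FunctionFieldPlace k) {R : Type*} [CommRing R] [Algebra R B]
    [Algebra R K] [IsScalarTower R B K] [Algebra.IsIntegral R B] [FaithfulSMul R B] {ϖ : R}
    (hϖ : ϖ ≠ 0)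
    (hle : ∀ r : R, v.val (algebraMap R K r) ≤ 1) (hlt : v.val (algebraMap R K ϖ) < 1) :
    ∃ P : HeightOneSpectrum B, algebraMap R B ϖ ∈ P.asIdeal ∧ v = ofPrime k P := by
  have hB : ∀ b : B, v.val (algebraMap B K b) ≤ 1 := fun b =>
    v.val_le_one_of_isIntegral hle ((Algebra.IsIntegral.isIntegral (R := R) b).algebraMap)
  have hmem : v.val (algebraMap B K (algebraMap R B ϖ)) < 1 := by
    rwa [← IsScalarTower.algebraMap_apply]
  obtain ⟨P, hP⟩ := exists_heightOneSpectrum_center v.val hB ⟨algebraMap R B ϖ, by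
    rwa [Ne, FaithfulSMul.algebraMap_eq_zero_iff], hmem⟩
  exact ⟨P, (hP _).2 hmem, ext (v.val_eq_valuation (isEquiv_valuation_of_center P hB hP))⟩

variable {R : Type*} [CommRing R] [IsDomain R] [IsPrincipalIdealRing R] [Algebra k R]
  [Algebra R B] [Algebra R K] [IsScalarTower R B K] [IsScalarTower k R B] [Module.Finite R B]
  [Module.Free R B] [Module.IsTorsionFree R B]

/-- The degree of the zero divisor of a prime element `ϖ` of `R` with residue field `k` is
the rank of `B` over `R`. -/
theorem sum_degree_mul_ord {ϖ : R} (hϖ : Prime ϖ)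
    (hk : Function.Bijective (algebraMap k (R ⧸ Ideal.span {ϖ})))
    (hle : ∀ v : FunctionFieldPlace k, v.val (algebraMap R K ϖ) < 1 →
      ∀ r : R, v.val (algebraMap R K r) ≤ 1) :
    {v : FunctionFieldPlace k | v.val (algebraMap R K ϖ) < 1}.Finite ∧
      ∑ᶠ v ∈ {v : FunctionFieldPlace k | v.val (algebraMap R K ϖ) < 1},
        (v.degree : ℝ) * WithZero.log (v.val (algebraMap R K ϖ)) = -(Module.finrank R B : ℝ) := by
  set p : Ideal R := Ideal.span {ϖ} with hp
  have hp0 : p ≠ ⊥ := by simpa [hp] using hϖ.ne_zero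
  have hpp : p.IsPrime := (Ideal.span_singleton_prime hϖ.ne_zero).2 hϖ
  have hpm : p.IsMaximal := hpp.isMaximal hp0
  have hmap : p.map (algebraMap R B) = Ideal.span {algebraMap R B ϖ} := by
    rw [hp, Ideal.map_span, Set.image_singleton]
  have hϖB : algebraMap R B ϖ ≠ 0 := by
    rw [Ne, FaithfulSMul.algebraMap_eq_zero_iff]; exact hϖ.ne_zero
  have hmap0 : p.map (algebraMap R B) ≠ ⊥ := by rw [hmap]; simpa using hϖB
  have hfin : Finite (p.primesOver B) := Algebra.QuasiFinite.finite_primesOver p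
  have := Fintype.ofFinite (p.primesOver B)
  have hlies : ∀ P : HeightOneSpectrum B, algebraMap R B ϖ ∈ P.asIdeal → P.asIdeal.LiesOver p := by
    intro P hP
    refine ⟨hpm.eq_of_le ?_ ?_⟩
    · exact (P.isPrime.under R).ne_top
    · rw [hp, Ideal.span_singleton_le_iff_mem]
      exact hP
  let Q : p.primesOver B → HeightOneSpectrum B := fun q =>
    ⟨q.1, q.2.1, fun h => hmap0 (le_bot_iff.1 (h ▸ Ideal.map_le_iff_le_comap.2 q.2.2.over.le))⟩
  have hQmem : ∀ q, algebraMap R B ϖ ∈ (Q q).asIdeal := fun q => by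
    have h : ϖ ∈ p := Ideal.mem_span_singleton_self ϖ
    rw [q.2.2.over] at h
    exact h
  have hQval : ∀ b P, (ofPrime k P).val (algebraMap B K b) = P.intValuation b := fun b P =>
    P.valuation_of_algebraMap b
  have hset : {v : FunctionFieldPlace k | v.val (algebraMap R K ϖ) < 1} =
      Set.range fun q => ofPrime k (Q q) := by
    ext v
    constructor
    · intro hv
      obtain ⟨P, hP, rfl⟩ := v.exists_ofPrime_eq (B := B) hϖ.ne_zero (hle v hv) hv
      exact ⟨⟨P.asIdeal, P.isPrime, hlies P hP⟩, rfl⟩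
    · rintro ⟨q, rfl⟩
      change (ofPrime k (Q q)).val _ < 1
      rw [IsScalarTower.algebraMap_apply R B K, hQval]
      exact ((Q q).intValuation_lt_one_iff_mem _).2 (hQmem q)
  have hinj : Function.Injective fun q => ofPrime k (Q q) := fun q q' h =>
    Subtype.ext (congrArg HeightOneSpectrum.asIdeal (ofPrime_injective h))
  rw [hset]
  refine ⟨Set.finite_range _, ?_⟩
  rw [finsum_mem_range hinj, finsum_eq_sum_of_fintype,
    ← Ideal.sum_ramification_inertia_eq_finrank p B, Nat.cast_sum, ← Finset.sum_neg_distrib]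
  refine Finset.sum_congr rfl fun q _ => ?_
  have hq : q.1.IsPrime := q.2.1
  have hqm : q.1.IsMaximal := (Q q).isMaximal
  have hqp : q.1.LiesOver p := q.2.2
  have hdeg : (ofPrime k (Q q)).degree = q.1.inertiaDeg R := by
    rw [degree_ofPrime, Ideal.inertiaDeg_eq_of_isMaximal p q.1]
    refine Algebra.finrank_eq_of_equiv_equiv (RingEquiv.ofBijective _ hk) (RingEquiv.refl _) ?_
    ext a
    exact congrArg (Ideal.Quotient.mk q.1) (IsScalarTower.algebraMap_apply k R B a).symm
  rw [hdeg, IsScalarTower.algebraMap_apply R B K, hQval,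
    HeightOneSpectrum.intValuation_eq_exp_neg_multiplicity _ hϖB, WithZero.log_exp,
    Ideal.IsDedekindDomain.ramificationIdx_eq_multiplicity p q.1 hmap0, hmap]
  push_cast
  ring

end Fiber

end FunctionFieldPlace

/-! ### The product formula for function fields -/

namespace FunctionFieldPlace

variable {K : Type*} [Field K] {k : Subfield K}

/-- `sum_degree_mul_ord` for the integral closure of `R` in `K`. -/
theorem sum_degree_mul_ord_integralClosure {R : Type*} (F : Type*) [CommRing R] [IsDomain R]
    [IsPrincipalIdealRing R] [Field F] [Algebra R F] [IsFractionRing R F] [Algebra F K]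
    [Algebra R K] [IsScalarTower R F K] [Algebra k R] [IsScalarTower k R K]
    [FiniteDimensional F K] [Algebra.IsSeparable F K] {ϖ : R} (hϖ : Prime ϖ)
    (hk : Function.Bijective (algebraMap k (R ⧸ Ideal.span {ϖ})))
    (hle : ∀ v : FunctionFieldPlace k, v.val (algebraMap R K ϖ) < 1 →
      ∀ r : R, v.val (algebraMap R K r) ≤ 1) :
    {v : FunctionFieldPlace k | v.val (algebraMap R K ϖ) < 1}.Finite ∧
      ∑ᶠ v ∈ {v : FunctionFieldPlace k | v.val (algebraMap R K ϖ) < 1},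
        (v.degree : ℝ) * WithZero.log (v.val (algebraMap R K ϖ)) = -(Module.finrank F K : ℝ) := by
  have : Module.IsTorsionFree R K := .trans_faithfulSMul R F K
  have : IsDedekindDomain (integralClosure R K) := integralClosure.isDedekindDomain R F K
  have : IsFractionRing (integralClosure R K) K :=
    integralClosure.isFractionRing_of_finite_extension F K
  have : Module.Finite R (integralClosure R K) := IsIntegralClosure.finite R F K _
  have : Module.Free R (integralClosure R K) := IsIntegralClosure.module_free R F K _
  rw [← IsIntegralClosure.rank R F K (integralClosure R K)]
  exact sum_degree_mul_ord (B := integralClosure R K) hϖ hk hle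

section AdjoinTranscendental

variable {x : K}

variable (k x) in
/-- The element `x` of the ring `k[x]`. -/
def adjoinGen : Algebra.adjoin k {x} := ⟨x, Algebra.self_mem_adjoin_singleton k x⟩

theorem algEquivOfTranscendental_X (hx : Transcendental k x) :
    Polynomial.algEquivOfTranscendental k x hx Polynomial.X = adjoinGen k x :=
  (Polynomial.algEquivOfTranscendental_apply k x hx _).trans (Polynomial.aeval_X _)

theorem isPrincipalIdealRing_adjoin (hx : Transcendental k x) :
    IsPrincipalIdealRing (Algebra.adjoin k {x}) :=
  .of_surjective (Polynomial.algEquivOfTranscendental k x hx :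
    Polynomial k →+* Algebra.adjoin k {x}) (Polynomial.algEquivOfTranscendental k x hx).surjective

theorem prime_adjoinGen (hx : Transcendental k x) : Prime (adjoinGen k x) := by
  rw [← algEquivOfTranscendental_X hx]
  exact (MulEquiv.prime_iff (Polynomial.algEquivOfTranscendental k x hx)).2 Polynomial.prime_X

theorem bijective_algebraMap_quotient_adjoinGen (hx : Transcendental k x) :
    Function.Bijective (algebraMap k (Algebra.adjoin k {x} ⧸ Ideal.span {adjoinGen k x})) := by
  have : Nontrivial (Algebra.adjoin k {x} ⧸ Ideal.span {adjoinGen k x}) :=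
    Ideal.Quotient.nontrivial_iff.2 fun h =>
      (prime_adjoinGen hx).not_isUnit (Ideal.span_singleton_eq_top.1 h)
  refine ⟨RingHom.injective _, fun y => ?_⟩
  obtain ⟨r, rfl⟩ := Ideal.Quotient.mk_surjective y
  let e := Polynomial.algEquivOfTranscendental k x hx
  obtain ⟨f, rfl⟩ := e.surjective r
  refine ⟨f.coeff 0, ?_⟩
  rw [eq_comm, IsScalarTower.algebraMap_apply k (Algebra.adjoin k {x}), ← e.commutes]
  refine Ideal.Quotient.eq.2 (Ideal.mem_span_singleton.2 ?_)
  rw [← map_sub, ← algEquivOfTranscendental_X hx]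
  exact map_dvd e Polynomial.X_dvd_sub_C

theorem val_le_one_of_mem_adjoin (v : FunctionFieldPlace k) (hv : v.val x ≤ 1)
    (r : Algebra.adjoin k {x}) : v.val (r : K) ≤ 1 := by
  let C : Subalgebra k K :=
    { v.val.integer with algebraMap_mem' := fun c => v.val_constant_le_one c }
  exact (Algebra.adjoin_le (S := C) (Set.singleton_subset_iff.2 hv)) r.2

open scoped IntermediateField.algebraAdjoinAdjoin in
/-- The degree of the divisor of zeros of a separating element `x` is `[K : k(x)]`. -/
theorem finsum_degree_mul_log_of_lt_one (hx : Transcendental k x)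
    [FiniteDimensional (IntermediateField.adjoin k {x}) K]
    [Algebra.IsSeparable (IntermediateField.adjoin k {x}) K] :
    {v : FunctionFieldPlace k | v.val x < 1}.Finite ∧
      ∑ᶠ v ∈ {v : FunctionFieldPlace k | v.val x < 1}, (v.degree : ℝ) * WithZero.log (v.val x) =
        -(Module.finrank (IntermediateField.adjoin k {x}) K : ℝ) := by
  have := isPrincipalIdealRing_adjoin hx
  exact sum_degree_mul_ord_integralClosure (IntermediateField.adjoin k {x}) (prime_adjoinGen hx)
    (bijective_algebraMap_quotient_adjoinGen hx)
    fun v hv => v.val_le_one_of_mem_adjoin (le_of_lt hv)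

end AdjoinTranscendental

theorem log_absVal (v : FunctionFieldPlace k) {x : K} (hx : x ≠ 0) :
    Real.log (v.absVal x) = WithZero.log (v.val x) := by
  obtain ⟨n, hn⟩ : ∃ n : ℤ, v.val x = WithZero.exp n :=
    ⟨_, (WithZero.exp_log ((Valuation.ne_zero_iff _).2 hx)).symm⟩
  change Real.log ((WithZeroMulInt.toNNReal one_lt_toNNReal_exp.ne_zero (v.val x) :
    NNReal) : ℝ) = _
  rw [hn, toNNReal_exp, WithZero.log_exp]
  rw [NNReal.coe_zpow, Real.coe_toNNReal _ (Real.exp_pos 1).le, Real.log_zpow, Real.log_exp,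
    mul_one]

theorem isNonarchimedean_absVal (v : FunctionFieldPlace k) : IsNonarchimedean v.absVal := by
  intro x y
  have hm := (WithZeroMulInt.toNNReal_strictMono one_lt_toNNReal_exp).monotone
  have h := hm (v.val.map_add x y)
  rw [hm.map_max] at h
  exact_mod_cast h

theorem absVal_eq_one_iff (v : FunctionFieldPlace k) (x : K) : v.absVal x = 1 ↔ v.val x = 1 := by
  have hinj := (WithZeroMulInt.toNNReal_strictMono one_lt_toNNReal_exp).injective
  change ((WithZeroMulInt.toNNReal one_lt_toNNReal_exp.ne_zero (v.val x) : NNReal) : ℝ) = 1 ↔ _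
  rw [NNReal.coe_eq_one]
  exact ⟨fun h => hinj (h.trans (map_one _).symm), fun h => by rw [h, map_one]⟩

open IntermediateField in
/-- The degree of the divisor of a separating element is zero: both its zeros and its poles have
total degree `[K : k(x)]`. -/
theorem product_formula_of_separating {x : K} (hx : Transcendental k x)
    [FiniteDimensional k⟮x⟯ K] [Algebra.IsSeparable k⟮x⟯ K] :
    {v : FunctionFieldPlace k | v.val x ≠ 1}.Finite ∧
      ∑ᶠ v : FunctionFieldPlace k, (v.degree : ℝ) * WithZero.log (v.val x) = 0 := by
  have hadj : k⟮x⁻¹⟯ = k⟮x⟯ := by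
    refine le_antisymm (adjoin_simple_le_iff.2 (inv_mem (mem_adjoin_simple_self k x)))
      (adjoin_simple_le_iff.2 ?_)
    simpa using inv_mem (mem_adjoin_simple_self k x⁻¹)
  have hx' : Transcendental k x⁻¹ := fun h => hx (by simpa using h.inv)
  obtain ⟨hfin, hsum⟩ := finsum_degree_mul_log_of_lt_one hx
  have : FiniteDimensional k⟮x⁻¹⟯ K := by rw [hadj]; infer_instance
  have : Algebra.IsSeparable k⟮x⁻¹⟯ K := by rw [hadj]; infer_instance
  obtain ⟨hfin', hsum'⟩ := finsum_degree_mul_log_of_lt_one hx'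
  have hx0 : x ≠ 0 := by
    rintro rfl
    exact hx isAlgebraic_zero
  set Z := {v : FunctionFieldPlace k | v.val x < 1}
  set P := {v : FunctionFieldPlace k | v.val x⁻¹ < 1} with hP
  have hPx : ∀ v, v ∈ P ↔ 1 < v.val x := fun v => by
    rw [hP, Set.mem_ofPred_eq, map_inv₀,
      inv_lt_one₀ (zero_lt_iff.2 ((Valuation.ne_zero_iff _).2 hx0))]
  have hunion : ∀ v : FunctionFieldPlace k, v.val x ≠ 1 → v ∈ Z ∪ P := fun v hv =>
    (lt_or_gt_of_ne hv).imp id (hPx v).2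
  have hdisj : Disjoint Z P := Set.disjoint_left.2 fun v hv hv' =>
    lt_asymm hv ((hPx v).1 hv')
  refine ⟨(hfin.union hfin').subset hunion, ?_⟩
  rw [← finsum_mem_univ, ← finsum_mem_inter_support, Set.univ_inter,
    ← Set.inter_eq_right.2 (show Function.support _ ⊆ Z ∪ P from ?_), finsum_mem_inter_support,
    finsum_mem_union hdisj hfin hfin', hsum]
  · have hneg : ∑ᶠ v ∈ P, (v.degree : ℝ) * WithZero.log (v.val x) =
        -∑ᶠ v ∈ P, (v.degree : ℝ) * WithZero.log (v.val x⁻¹) := by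
      rw [← finsum_mem_neg_distrib _ hfin']
      refine finsum_mem_congr rfl fun v _ => ?_
      rw [map_inv₀, WithZero.log_inv]
      push_cast
      ring
    rw [hneg, hsum', hadj]
    ring
  · intro v hv
    refine hunion v fun h => hv ?_
    simp [h]

open IntermediateField in
/-- The degree of a principal divisor is zero. Every function is a quotient of two separating ones,
for which this is `product_formula_of_separating`. -/
theorem degree_principal_divisor [Finite k]
    (h : ∃ t : K, Transcendental k t ∧ FiniteDimensional k⟮t⟯ K ∧ Algebra.IsSeparable k⟮t⟯ K)
    {x : K} (hx : x ≠ 0) :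
    {v : FunctionFieldPlace k | v.val x ≠ 1}.Finite ∧
      ∑ᶠ v : FunctionFieldPlace k, (v.degree : ℝ) * WithZero.log (v.val x) = 0 := by
  obtain ⟨t, ht, hfin, hsep⟩ := h
  have key : ∀ u : K, KaehlerDifferential.D k K u ≠ 0 →
      {v : FunctionFieldPlace k | v.val u ≠ 1}.Finite ∧
        ∑ᶠ v : FunctionFieldPlace k, (v.degree : ℝ) * WithZero.log (v.val u) = 0 := by
    intro u hu
    obtain ⟨h1, h2⟩ := isSeparable_of_D_ne_zero (t := t) hu
    exact product_formula_of_separating (transcendental_of_D_ne_zero hu)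
  rcases exists_separating_quotient ht hx with hD | ⟨y, z, hy, hz, rfl, hz0⟩
  · exact key x hD
  obtain ⟨hfy, hsy⟩ := key _ hy
  obtain ⟨hfz, hsz⟩ := key _ hz
  have hval : ∀ v : FunctionFieldPlace k, v.val x ≠ 0 ∧ v.val z ≠ 0 := fun v =>
    ⟨(Valuation.ne_zero_iff _).2 hx, (Valuation.ne_zero_iff _).2 hz0⟩
  refine ⟨(hfy.union hfz).subset fun v hv => ?_, ?_⟩
  · by_contra hcon
    rw [Set.mem_union, not_or, Set.mem_ofPred_eq, Set.mem_ofPred_eq, not_not, not_not,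
      map_mul] at hcon
    exact hv (by simpa [hcon.2] using hcon.1)
  · have hsupp : ∀ u : K, (Function.support fun v : FunctionFieldPlace k =>
        (v.degree : ℝ) * WithZero.log (v.val u)) ⊆ {v | v.val u ≠ 1} := by
      intro u v hv hu
      exact hv (by simp [hu])
    have hsub := finsum_sub_distrib (hfy.subset (hsupp _)) (hfz.subset (hsupp _))
    rw [hsy, hsz, sub_zero] at hsub
    rw [← hsub]
    refine finsum_congr fun v => ?_
    rw [map_mul, WithZero.log_mul (hval v).1 (hval v).2]
    push_cast
    ring

end FunctionFieldPlace

/-! ### Places of global fields -/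

namespace GlobalField

variable {K : Type*} [Field K] (𝔎 : GlobalField K)

theorem finite_absVal_ne_one {x : K} (hx : x ≠ 0) :
    {v : 𝔎.Place | 𝔎.absVal v x ≠ 1}.Finite := by
  cases 𝔎 with
  | numberField _ => exact NumberFieldPlace.finite_ne_one hx
  | functionField k _ h =>
    exact (FunctionFieldPlace.degree_principal_divisor h hx).1.subset fun v hv h1 =>
      hv ((v.absVal_eq_one_iff x).2 h1)

theorem finite_not_isNonarchimedean :
    {v : 𝔎.Place | ¬ IsNonarchimedean (𝔎.absVal v)}.Finite := by
  cases 𝔎 with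
  | numberField _ => exact NumberFieldPlace.finite_not_isNonarchimedean
  | functionField k _ h =>
    exact Set.finite_empty.subset fun v hv => hv v.isNonarchimedean_absVal

theorem product_formula {x : K} (hx : x ≠ 0) :
    ∑ᶠ v : 𝔎.Place, (𝔎.localDegree v : ℝ) * Real.log (𝔎.absVal v x) = 0 := by
  cases 𝔎 with
  | numberField _ => exact NumberFieldPlace.product_formula hx
  | functionField k _ h =>
    rw [← (FunctionFieldPlace.degree_principal_divisor h hx).2]
    exact finsum_congr fun v => congrArg _ (v.log_absVal hx)

end GlobalField

/-! ### Local estimates for homogeneous polynomials -/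

section LocalEstimates

open MvPolynomial

variable {K E : Type*} [Field K] [NormedField E] [Algebra K E]

theorem norm_prod_pow_le (z : Fin 2 → E) (m : Fin 2 →₀ ℕ) :
    ‖∏ i ∈ m.support, z i ^ m i‖ ≤ max ‖z 0‖ ‖z 1‖ ^ m.degree := by
  rw [norm_prod, Finsupp.degree_apply, ← Finset.prod_pow_eq_pow_sum]
  refine Finset.prod_le_prod (fun i _ => norm_nonneg _) fun i _ => ?_
  rw [norm_pow]
  refine pow_le_pow_left₀ (norm_nonneg _) ?_ _
  fin_cases i
  · exact le_max_left _ _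
  · exact le_max_right _ _

theorem norm_aeval_le_sum {p : MvPolynomial (Fin 2) K} {d : ℕ} (hp : p.IsHomogeneous d)
    (z : Fin 2 → E) :
    ‖aeval z p‖ ≤ (∑ m ∈ p.support, ‖algebraMap K E (p.coeff m)‖) * max ‖z 0‖ ‖z 1‖ ^ d := by
  rw [aeval_def, eval₂_eq, Finset.sum_mul]
  refine (norm_sum_le _ _).trans (Finset.sum_le_sum fun m hm => ?_)
  have hd : m.degree = d := by
    rw [Finsupp.degree_apply]; exact (hp.degree_eq_sum_deg_support hm).symm
  rw [norm_mul, ← hd]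
  exact mul_le_mul_of_nonneg_left (norm_prod_pow_le z m) (norm_nonneg _)

theorem norm_aeval_le_of_isUltrametricDist [IsUltrametricDist E] {p : MvPolynomial (Fin 2) K}
    {d : ℕ} (hp : p.IsHomogeneous d) (hc : ∀ m ∈ p.support, ‖algebraMap K E (p.coeff m)‖ ≤ 1)
    (z : Fin 2 → E) : ‖aeval z p‖ ≤ max ‖z 0‖ ‖z 1‖ ^ d := by
  rw [aeval_def, eval₂_eq]
  refine IsUltrametricDist.norm_sum_le_of_forall_le_of_nonneg (by positivity) fun m hm => ?_
  have hd : m.degree = d := by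
    rw [Finsupp.degree_apply]; exact (hp.degree_eq_sum_deg_support hm).symm
  rw [norm_mul, ← hd]
  exact (mul_le_of_le_one_left (norm_nonneg _) (hc m hm)).trans (norm_prod_pow_le z m)

end LocalEstimates

/-- Effective form of the Nullstellensatz for a lift: a power of each coordinate is a combination
of the two forms with homogeneous coefficients. -/
theorem Lift.exists_pow_eq {K : Type*} [Field K] (L : Lift K) :
    ∃ N : ℕ, ∀ i : Fin 2, ∃ A B : MvPolynomial (Fin 2) K, A.IsHomogeneous N ∧ B.IsHomogeneous N ∧
      A * L.F + B * L.G = MvPolynomial.X i ^ (N + L.degree) := by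
  classical
  set I : Ideal (MvPolynomial (Fin 2) K) := Ideal.span {L.F, L.G} with hI
  have hrad : ∀ i, (MvPolynomial.X i : MvPolynomial (Fin 2) K) ∈ I.radical := by
    intro i
    rw [← MvPolynomial.vanishingIdeal_zeroLocus_eq_radical (K := AlgebraicClosure K)]
    intro z hz
    have h0 := L.eq_zero_of_common_zero z (hz _ (Ideal.subset_span (by simp)))
      (hz _ (Ideal.subset_span (by simp)))
    simp [h0]
  choose n hn using hrad
  refine ⟨n 0 + n 1, fun i => ?_⟩
  have hmem : (MvPolynomial.X i : MvPolynomial (Fin 2) K) ^ (n 0 + n 1 + L.degree) ∈ I := by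
    refine Ideal.mem_of_dvd _ (pow_dvd_pow _ ?_) (hn i)
    fin_cases i <;> simp <;> omega
  obtain ⟨a, b, hab⟩ := Ideal.mem_span_pair.1 hmem
  set N := n 0 + n 1
  let 𝒜 := MvPolynomial.homogeneousSubmodule (Fin 2) K
  let _ : GradedAlgebra 𝒜 := MvPolynomial.gradedAlgebra
  refine ⟨DirectSum.decompose 𝒜 a N, DirectSum.decompose 𝒜 b N,
    (DirectSum.decompose 𝒜 a N).2, (DirectSum.decompose 𝒜 b N).2, ?_⟩
  have hX : (MvPolynomial.X i : MvPolynomial (Fin 2) K) ^ (N + L.degree) ∈ 𝒜 (N + L.degree) :=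
    MvPolynomial.isHomogeneous_X_pow i _
  -- the homogeneous component of degree `N + L.degree` of the relation `hab`
  have h := congrArg (fun q => (DirectSum.decompose 𝒜 q (N + L.degree) :
    MvPolynomial (Fin 2) K)) hab
  simp only [DirectSum.decompose_add, DirectSum.add_apply, Submodule.coe_add] at h
  rw [DirectSum.coe_decompose_mul_add_of_right_mem 𝒜 (i := N) (j := L.degree) (b := L.F)
      L.homogeneous_F,
    DirectSum.coe_decompose_mul_add_of_right_mem 𝒜 (i := N) (j := L.degree) (b := L.G)
      L.homogeneous_G, DirectSum.decompose_of_mem_same 𝒜 hX] at h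
  exact h

/-! ### Local distortion of lifts -/

namespace GlobalField

variable {K : Type*} [Field K] (𝔎 : GlobalField K)

theorem vnorm_nonneg (v : 𝔎.Place) (z : Fin 2 → 𝔎.Completion v) : 0 ≤ 𝔎.vnorm v z :=
  (norm_nonneg _).trans (le_max_left _ _)

theorem vnorm_pos {v : 𝔎.Place} {z : Fin 2 → 𝔎.Completion v} (hz : z ≠ 0) : 0 < 𝔎.vnorm v z := by
  by_contra h
  apply hz
  have h0 : ‖z 0‖ ≤ 0 := (le_max_left _ _).trans (not_lt.1 h)
  have h1 : ‖z 1‖ ≤ 0 := (le_max_right _ _).trans (not_lt.1 h)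
  funext i
  fin_cases i
  · simpa using h0
  · simpa using h1

theorem norm_le_vnorm {v : 𝔎.Place} (z : Fin 2 → 𝔎.Completion v) (i : Fin 2) :
    ‖z i‖ ≤ 𝔎.vnorm v z := by
  fin_cases i
  · exact le_max_left _ _
  · exact le_max_right _ _

theorem exists_bound_add : ∃ c : 𝔎.Place → ℝ, (∀ v, 1 ≤ c v) ∧ {v | c v ≠ 1}.Finite ∧
    ∀ v, ∀ a b : 𝔎.Completion v, ‖a + b‖ ≤ c v * max ‖a‖ ‖b‖ := by
  classical
  refine ⟨fun v => if IsNonarchimedean (𝔎.absVal v) then 1 else 2,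
    fun v => ?_, ?_, fun v a b => ?_⟩
  · dsimp only; split_ifs <;> norm_num
  · refine 𝔎.finite_not_isNonarchimedean.subset fun v hv h => hv ?_
    simp [h]
  · dsimp only
    split_ifs with h
    · have := isUltrametricDist_completion h
      rw [one_mul]
      exact IsUltrametricDist.norm_add_le_max a b
    · linarith [norm_add_le a b, le_max_left ‖a‖ ‖b‖, le_max_right ‖a‖ ‖b‖]

theorem exists_bound_aeval {p : MvPolynomial (Fin 2) K} {d : ℕ} (hp : p.IsHomogeneous d) :
    ∃ c : 𝔎.Place → ℝ, (∀ v, 1 ≤ c v) ∧ {v | c v ≠ 1}.Finite ∧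
      ∀ v, ∀ z : Fin 2 → 𝔎.Completion v, ‖MvPolynomial.aeval z p‖ ≤ c v * 𝔎.vnorm v z ^ d := by
  classical
  refine ⟨fun v => if IsNonarchimedean (𝔎.absVal v) ∧
      ∀ m ∈ p.support, 𝔎.absVal v (p.coeff m) = 1 then 1 else
        max 1 (∑ m ∈ p.support, ‖algebraMap K (𝔎.Completion v) (p.coeff m)‖),
    fun v => ?_, ?_, fun v z => ?_⟩
  · dsimp only; split_ifs
    · exact le_rfl
    · exact le_max_left _ _
  · refine (𝔎.finite_not_isNonarchimedean.union
      (p.support.finite_toSet.biUnion fun m hm => 𝔎.finite_absVal_ne_one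
        (MvPolynomial.mem_support_iff.1 (Finset.mem_coe.1 hm)))).subset fun v hv => ?_
    by_contra h
    simp only [Set.mem_union, Set.mem_iUnion, Set.mem_ofPred_eq, not_or, not_not, not_exists,
      Finset.mem_coe] at h
    exact hv (if_pos h)
  · dsimp only
    split_ifs with h
    · have := isUltrametricDist_completion h.1
      rw [one_mul]
      exact norm_aeval_le_of_isUltrametricDist hp
        (fun m hm => ((norm_algebraMap_completion _ _).trans (h.2 m hm)).le) z
    · exact (norm_aeval_le_sum hp z).trans
        (mul_le_mul_of_nonneg_right (le_max_right _ _) (pow_nonneg (𝔎.vnorm_nonneg v z) _))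

/-- A lift of degree `d` distorts `d * log ‖z‖_v` by a bounded amount at every place, and by
nothing at almost every place. -/
theorem exists_bound_map (L : Lift K) :
    ∃ c : 𝔎.Place → ℝ, (∀ v, 0 ≤ c v) ∧ {v | c v ≠ 0}.Finite ∧
      ∀ v, ∀ z : Fin 2 → 𝔎.Completion v, z ≠ 0 → L.map z ≠ 0 ∧
        |Real.log (𝔎.vnorm v (L.map z)) - L.degree * Real.log (𝔎.vnorm v z)| ≤ c v := by
  obtain ⟨e, he1, hef, he⟩ := 𝔎.exists_bound_add
  obtain ⟨cF, hF1, hFf, hF⟩ := 𝔎.exists_bound_aeval L.homogeneous_F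
  obtain ⟨cG, hG1, hGf, hG⟩ := 𝔎.exists_bound_aeval L.homogeneous_G
  obtain ⟨N, hN⟩ := L.exists_pow_eq
  choose A B hA hB hAB using hN
  choose cA hA1 hAf hA using fun i => 𝔎.exists_bound_aeval (hA i)
  choose cB hB1 hBf hB using fun i => 𝔎.exists_bound_aeval (hB i)
  -- `up` bounds the lift from above; `lo` bounds it from below, through the relations `hAB`
  set up : 𝔎.Place → ℝ := fun v => cF v * cG v with hup
  set lo : 𝔎.Place → ℝ := fun v => e v * ∏ i, (cA i v * cB i v) with hlo
  have hup1 : ∀ v, 1 ≤ up v := fun v => one_le_mul_of_one_le_of_one_le (hF1 v) (hG1 v)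
  have hi1 : ∀ v i, 1 ≤ cA i v * cB i v := fun v i =>
    one_le_mul_of_one_le_of_one_le (hA1 i v) (hB1 i v)
  have hprod1 : ∀ v i, cA i v * cB i v ≤ ∏ i, (cA i v * cB i v) := fun v i => by
    have h0 := hi1 v 0
    have h1 := hi1 v 1
    rw [Fin.prod_univ_two]
    fin_cases i
    · exact le_mul_of_one_le_right (by simpa using zero_le_one.trans h0) h1
    · exact le_mul_of_one_le_left (by simpa using zero_le_one.trans h1) h0
  have hlo1 : ∀ v, 1 ≤ lo v := fun v =>
    one_le_mul_of_one_le_of_one_le (he1 v) ((hi1 v 0).trans (hprod1 v 0))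
  refine ⟨fun v => Real.log (up v) + Real.log (lo v),
    fun v => add_nonneg (Real.log_nonneg (hup1 v)) (Real.log_nonneg (hlo1 v)), ?_,
    fun v z hz => ?_⟩
  · refine (((hef.union hFf).union hGf).union ((Set.finite_iUnion hAf).union
      (Set.finite_iUnion hBf))).subset fun v hv => ?_
    by_contra h
    simp only [Set.mem_union, Set.mem_iUnion, Set.mem_ofPred_eq, not_or, not_not, not_exists] at h
    apply hv
    simp [hup, hlo, h.1.1.1, h.1.1.2, h.1.2, h.2.1, h.2.2]
  set w := L.map z with hw
  have hw0 : w 0 = MvPolynomial.aeval z L.F := rfl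
  have hw1 : w 1 = MvPolynomial.aeval z L.G := rfl
  have hr : 0 < 𝔎.vnorm v z := 𝔎.vnorm_pos hz
  set r := 𝔎.vnorm v z with hrdef
  set s := 𝔎.vnorm v w with hsdef
  have hs0 : 0 ≤ s := 𝔎.vnorm_nonneg v w
  have hle : s ≤ up v * r ^ L.degree := by
    refine max_le ?_ ?_
    · rw [hw0]
      refine (hF v z).trans (mul_le_mul_of_nonneg_right ?_ (by positivity))
      exact le_mul_of_one_le_right (zero_le_one.trans (hF1 v)) (hG1 v)
    · rw [hw1]
      refine (hG v z).trans (mul_le_mul_of_nonneg_right ?_ (by positivity))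
      exact le_mul_of_one_le_left (zero_le_one.trans (hG1 v)) (hF1 v)
  have hcoord : ∀ i, ‖z i‖ ^ (N + L.degree) ≤ lo v * r ^ N * s := fun i => by
    have h := congrArg (MvPolynomial.aeval z) (hAB i)
    simp only [map_add, map_mul, map_pow, MvPolynomial.aeval_X] at h
    rw [← norm_pow, ← h]
    refine (he v _ _).trans ?_
    rw [mul_assoc, hlo]
    simp only
    rw [mul_assoc]
    refine mul_le_mul_of_nonneg_left ?_ (zero_le_one.trans (he1 v))
    have hi0 : 0 ≤ cA i v := zero_le_one.trans (hA1 i v)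
    have hi0' : 0 ≤ cB i v := zero_le_one.trans (hB1 i v)
    have hAle : cA i v ≤ ∏ i, (cA i v * cB i v) :=
      (le_mul_of_one_le_right hi0 (hB1 i v)).trans (hprod1 v i)
    have hBle : cB i v ≤ ∏ i, (cA i v * cB i v) :=
      (le_mul_of_one_le_left hi0' (hA1 i v)).trans (hprod1 v i)
    rw [← mul_assoc]
    refine max_le ?_ ?_
    · rw [norm_mul]
      exact mul_le_mul ((hA i v z).trans (mul_le_mul_of_nonneg_right hAle (by positivity)))
        (𝔎.norm_le_vnorm w 0) (norm_nonneg _) (mul_nonneg (hi0.trans hAle) (by positivity))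
    · rw [norm_mul]
      exact mul_le_mul ((hB i v z).trans (mul_le_mul_of_nonneg_right hBle (by positivity)))
        (𝔎.norm_le_vnorm w 1) (norm_nonneg _) (mul_nonneg (hi0.trans hAle) (by positivity))
  have hge : r ^ L.degree ≤ lo v * s := by
    have h : r ^ (N + L.degree) ≤ lo v * r ^ N * s := by
      rcases max_choice ‖z 0‖ ‖z 1‖ with h | h
      · have := hcoord 0
        rwa [← h] at this
      · have := hcoord 1
        rwa [← h] at this
    rw [pow_add] at h
    refine le_of_mul_le_mul_left (h.trans_eq (by ring)) (pow_pos hr N)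
  have hs : 0 < s := by
    refine hs0.lt_of_ne fun h => ?_
    rw [← h, mul_zero] at hge
    exact absurd (pow_pos hr L.degree) (not_lt.2 hge)
  refine ⟨fun h => hs.ne' (by simp [hsdef, h, vnorm]), ?_⟩
  have hup0 := zero_lt_one.trans_le (hup1 v)
  have hlo0 := zero_lt_one.trans_le (hlo1 v)
  have l1 := Real.log_le_log hs hle
  rw [Real.log_mul hup0.ne' (pow_pos hr _).ne', Real.log_pow] at l1
  have l2 := Real.log_le_log (pow_pos hr _) hge
  rw [Real.log_mul hlo0.ne' hs.ne', Real.log_pow] at l2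
  have l3 := Real.log_nonneg (hup1 v)
  have l4 := Real.log_nonneg (hlo1 v)
  rw [abs_le]
  constructor <;> linarith

end GlobalField

/-! ### Iteration and the Green functions -/

namespace Lift

variable {K : Type*} [Field K]

theorem two_pow_le_iterDegree {γ : ℕ → Lift K} (h : ∀ n, 2 ≤ (γ n).degree) (n : ℕ) :
    2 ^ n ≤ iterDegree γ n := by
  simpa [iterDegree] using
    Finset.prod_le_prod' (s := Finset.range n) (f := fun _ => 2) fun i _ => h i

theorem iterDegree_succ (γ : ℕ → Lift K) (n : ℕ) :
    iterDegree γ (n + 1) = (γ n).degree * iterDegree γ n := by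
  rw [iterDegree, Finset.prod_range_succ, mul_comm, iterDegree]

theorem iter_ne_zero (γ : ℕ → Lift K) {z : Fin 2 → K} (hz : z ≠ 0) : ∀ n, iter γ z n ≠ 0
  | 0 => hz
  | n + 1 => (γ n).map_ne_zero (iter_ne_zero γ hz n)

theorem algebraMap_comp_map (L : Lift K) {A : Type*} [CommRing A] [Algebra K A] (z : Fin 2 → K) :
    L.map (fun i => algebraMap K A (z i)) = fun i => algebraMap K A (L.map z i) := by
  funext i
  fin_cases i
  · exact MvPolynomial.aeval_algebraMap_apply A z L.F
  · exact MvPolynomial.aeval_algebraMap_apply A z L.G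

theorem iter_algebraMap (γ : ℕ → Lift K) {A : Type*} [CommRing A] [Algebra K A] (z : Fin 2 → K) :
    ∀ n, iter γ (fun i => algebraMap K A (z i)) n = fun i => algebraMap K A (iter γ z n i)
  | 0 => rfl
  | n + 1 => by
    rw [iter, iter_algebraMap γ z n, algebraMap_comp_map, iter]

end Lift

namespace Endo

variable {K : Type*} [Field K]

theorem iter_mk (γ : ℕ → Endo K) (γ' : ℕ → Lift K) (h : ∀ n, ofLift (γ' n) = γ n)
    {z : Fin 2 → K} (hz : z ≠ 0) :
    ∀ n, iter γ (Projectivization.mk K z hz) n =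
      Projectivization.mk K (Lift.iter γ' z n) (Lift.iter_ne_zero γ' hz n)
  | 0 => rfl
  | n + 1 => by
    rw [iter, iter_mk γ γ' h hz n, ← h n]
    rfl

theorem iterDegree_eq (γ : ℕ → Endo K) (γ' : ℕ → Lift K) (h : ∀ n, ofLift (γ' n) = γ n) (n : ℕ) :
    iterDegree γ n = Lift.iterDegree γ' n :=
  Finset.prod_congr rfl fun i _ => by rw [← h i]; rfl

end Endo

namespace GlobalField

variable {K : Type*} [Field K] (𝔎 : GlobalField K)

/-- If all the lifts have degree at least two and a common distortion bound `c`, the sequence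
defining the Green function converges geometrically. -/
theorem tendsto_greenSeq {γ : ℕ → Lift K} (hdeg : ∀ n, 2 ≤ (γ n).degree) {v : 𝔎.Place} {c : ℝ}
    (hc : ∀ n, ∀ z : Fin 2 → 𝔎.Completion v, z ≠ 0 → (γ n).map z ≠ 0 ∧
      |Real.log (𝔎.vnorm v ((γ n).map z)) - (γ n).degree * Real.log (𝔎.vnorm v z)| ≤ c)
    {z : Fin 2 → 𝔎.Completion v} (hz : z ≠ 0) :
    Tendsto (𝔎.greenSeq v γ z) atTop (𝓝 (𝔎.green v γ z)) ∧
      |𝔎.green v γ z - Real.log (𝔎.vnorm v z)| ≤ c := by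
  have hne : ∀ n, Lift.iter γ z n ≠ 0 := by
    intro n
    induction n with
    | zero => exact hz
    | succ n ih => exact (hc n _ ih).1
  have hc0 : 0 ≤ c := (abs_nonneg _).trans (hc 0 z hz).2
  have hstep : ∀ n, dist (𝔎.greenSeq v γ z n) (𝔎.greenSeq v γ z (n + 1)) ≤ c / 2 / 2 ^ n := by
    intro n
    have hD : (2 : ℝ) ^ n ≤ (Lift.iterDegree γ n : ℝ) := by
      exact_mod_cast Lift.two_pow_le_iterDegree hdeg n
    have hD0 : (0 : ℝ) < Lift.iterDegree γ n := lt_of_lt_of_le (by positivity) hD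
    have hd : (2 : ℝ) ≤ ((γ n).degree : ℝ) := by exact_mod_cast hdeg n
    have hd0 : (0 : ℝ) < ((γ n).degree : ℝ) := by linarith
    have h := (hc n _ (hne n)).2
    rw [dist_comm, Real.dist_eq, greenSeq, greenSeq, Lift.iterDegree_succ, Nat.cast_mul]
    have heq : Real.log (𝔎.vnorm v (Lift.iter γ z (n + 1))) /
          (((γ n).degree : ℝ) * (Lift.iterDegree γ n : ℝ)) -
        Real.log (𝔎.vnorm v (Lift.iter γ z n)) / (Lift.iterDegree γ n : ℝ) =
        (Real.log (𝔎.vnorm v ((γ n).map (Lift.iter γ z n))) -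
          (γ n).degree * Real.log (𝔎.vnorm v (Lift.iter γ z n))) /
          (((γ n).degree : ℝ) * (Lift.iterDegree γ n : ℝ)) := by
      rw [Lift.iter]
      field_simp
    rw [heq, abs_div, abs_of_pos (mul_pos hd0 hD0), div_div]
    gcongr
  obtain ⟨l, hl⟩ := cauchySeq_tendsto_of_complete (cauchySeq_of_le_geometric_two hstep)
  have hgreen : 𝔎.green v γ z = l := hl.limUnder_eq
  rw [hgreen]
  refine ⟨hl, ?_⟩
  have h := dist_le_of_le_geometric_two_of_tendsto₀ hstep hl
  rw [dist_comm, Real.dist_eq] at h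
  simpa [greenSeq, Lift.iter, Lift.iterDegree] using h

theorem vnorm_embed (v : 𝔎.Place) (z : Fin 2 → K) :
    𝔎.vnorm v (𝔎.embed v z) = max (𝔎.absVal v (z 0)) (𝔎.absVal v (z 1)) := by
  rw [vnorm, embed, embed, norm_algebraMap_completion, norm_algebraMap_completion]

theorem embed_ne_zero (v : 𝔎.Place) {z : Fin 2 → K} (hz : z ≠ 0) : 𝔎.embed v z ≠ 0 := by
  refine fun h => hz (funext fun i => ?_)
  have := congrArg norm (congrFun h i)
  rw [embed, norm_algebraMap_completion] at this
  simpa using this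

theorem finite_vnorm_embed_ne_one {z : Fin 2 → K} (hz : z ≠ 0) :
    {v | 𝔎.vnorm v (𝔎.embed v z) ≠ 1}.Finite := by
  have hcoord : ∀ i, {v : 𝔎.Place | 𝔎.absVal v (z i) ≠ 1 ∧ z i ≠ 0}.Finite := fun i => by
    by_cases h : z i = 0
    · simp [h]
    · exact (𝔎.finite_absVal_ne_one h).subset fun v hv => hv.1
  refine ((hcoord 0).union (hcoord 1)).subset fun v hv => ?_
  by_contra h
  apply hv
  simp only [Set.mem_union, Set.mem_ofPred_eq, not_or, not_and_or, not_not] at h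
  rw [vnorm_embed]
  rcases h with ⟨h0 | h0, h1 | h1⟩
  · simp [h0, h1]
  · simp [h0, h1]
  · simp [h0, h1]
  · exact absurd (funext fun i => by fin_cases i <;> assumption) hz

/-- By the product formula the Weil height does not depend on the representative. -/
theorem weilHeight_mk {z : Fin 2 → K} (hz : z ≠ 0) :
    𝔎.weilHeight (Projectivization.mk K z hz) =
      ∑ᶠ v : 𝔎.Place, (𝔎.localDegree v : ℝ) * Real.log (𝔎.vnorm v (𝔎.embed v z)) := by
  obtain ⟨a, ha⟩ := Projectivization.exists_smul_eq_mk_rep K z hz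
  have key : ∀ v : 𝔎.Place, (𝔎.localDegree v : ℝ) *
      Real.log (max (𝔎.absVal v ((Projectivization.mk K z hz).rep 0))
        (𝔎.absVal v ((Projectivization.mk K z hz).rep 1))) =
      (𝔎.localDegree v : ℝ) * Real.log (𝔎.absVal v (a : K)) +
        (𝔎.localDegree v : ℝ) * Real.log (𝔎.vnorm v (𝔎.embed v z)) := fun v => by
    have hpos : 0 < 𝔎.absVal v (a : K) := (𝔎.absVal v).pos a.ne_zero
    rw [← ha, vnorm_embed, ← mul_add, ← Real.log_mul hpos.ne', mul_max_of_nonneg _ _ hpos.le]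
    · simp [Units.smul_def]
    · rw [← vnorm_embed]
      exact (𝔎.vnorm_pos (𝔎.embed_ne_zero v hz)).ne'
  rw [weilHeight, finsum_congr key, finsum_add_distrib, 𝔎.product_formula a.ne_zero, zero_add]
  · refine (𝔎.finite_absVal_ne_one a.ne_zero).subset fun v hv h => hv ?_
    simp [h]
  · refine (𝔎.finite_vnorm_embed_ne_one hz).subset fun v hv h => hv ?_
    simp [h]

end GlobalField

end RandomDynamics

/-! ### Canonical heights as sums of Green functions -/

theorem proposition4p1 {K : Type*} [Field K] (𝔎 : RandomDynamics.GlobalField K)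
    (S : Set (RandomDynamics.Endo K)) (hS : S.Finite)
    (hdeg : ∀ φ ∈ S, 2 ≤ φ.degree)
    (lift : S → RandomDynamics.Lift K)
    (hlift : ∀ φ : S, RandomDynamics.Endo.ofLift (lift φ) = φ) :
    (∃ C : 𝔎.Place → ℝ, {v | C v ≠ 0}.Finite ∧
      ∀ (γ : ℕ → S) (v : 𝔎.Place) (z : Fin 2 → 𝔎.Completion v), z ≠ 0 →
        Tendsto (𝔎.greenSeq v (fun i => lift (γ i)) z) atTop
          (𝓝 (𝔎.green v (fun i => lift (γ i)) z)) ∧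
        |𝔎.green v (fun i => lift (γ i)) z - Real.log (𝔎.vnorm v z)| ≤ C v) ∧
    ∀ (γ : ℕ → S) (z : Fin 2 → K) (hz : z ≠ 0),
      Tendsto (𝔎.heightSeq (fun i => (γ i : RandomDynamics.Endo K))
          (Projectivization.mk K z hz)) atTop
        (𝓝 (𝔎.canonicalHeight (fun i => (γ i : RandomDynamics.Endo K))
          (Projectivization.mk K z hz))) ∧
      {v : 𝔎.Place | (𝔎.localDegree v : ℝ) *
        𝔎.green v (fun i => lift (γ i)) (𝔎.embed v z) ≠ 0}.Finite ∧
      𝔎.canonicalHeight (fun i => (γ i : RandomDynamics.Endo K)) (Projectivization.mk K z hz) =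
        ∑ᶠ v : 𝔎.Place, (𝔎.localDegree v : ℝ) *
          𝔎.green v (fun i => lift (γ i)) (𝔎.embed v z) := by
  classical
  have hSfin : Finite S := hS
  have := Fintype.ofFinite S
  have hdeg' : ∀ φ : S, 2 ≤ (lift φ).degree := fun φ => by
    have h := hdeg φ φ.2
    rw [← hlift φ] at h
    exact h
  choose c hc0 hcf hc using fun φ : S => 𝔎.exists_bound_map (lift φ)
  set C : 𝔎.Place → ℝ := fun v => ∑ φ, c φ v with hC
  have hCle : ∀ φ v, c φ v ≤ C v := fun φ v =>
    Finset.single_le_sum (f := fun φ => c φ v) (fun φ _ => hc0 φ v) (Finset.mem_univ φ)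
  have hCf : {v | C v ≠ 0}.Finite := by
    refine (Set.finite_iUnion hcf).subset fun v hv => ?_
    by_contra h
    simp only [Set.mem_iUnion, Set.mem_ofPred_eq, not_exists, not_not] at h
    exact hv (Finset.sum_eq_zero fun φ _ => h φ)
  have hgreen : ∀ (γ : ℕ → S) (v : 𝔎.Place) (z : Fin 2 → 𝔎.Completion v), z ≠ 0 →
      Tendsto (𝔎.greenSeq v (fun i => lift (γ i)) z) atTop
        (𝓝 (𝔎.green v (fun i => lift (γ i)) z)) ∧
      |𝔎.green v (fun i => lift (γ i)) z - Real.log (𝔎.vnorm v z)| ≤ C v := fun γ v z hz =>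
    𝔎.tendsto_greenSeq (fun n => hdeg' (γ n))
      (fun n w hw => ⟨(hc (γ n) v w hw).1, (hc (γ n) v w hw).2.trans (hCle _ v)⟩) hz
  refine ⟨⟨C, hCf, hgreen⟩, fun γ z hz => ?_⟩
  set γ' : ℕ → RandomDynamics.Lift K := fun i => lift (γ i) with hγ'
  set T : Set 𝔎.Place := {v | C v ≠ 0} ∪ {v | 𝔎.vnorm v (𝔎.embed v z) ≠ 1} with hT
  have hTf : T.Finite := hCf.union (𝔎.finite_vnorm_embed_ne_one hz)
  -- Outside `T` the maps preserve the norm exactly, so that all terms are zero.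
  have hout : ∀ v, v ∉ T → ∀ n, 𝔎.greenSeq v γ' (𝔎.embed v z) n = 0 := by
    intro v hv n
    simp only [hT, Set.mem_union, Set.mem_ofPred_eq, not_or, not_not] at hv
    suffices h : RandomDynamics.Lift.iter γ' (𝔎.embed v z) n ≠ 0 ∧
        Real.log (𝔎.vnorm v (RandomDynamics.Lift.iter γ' (𝔎.embed v z) n)) = 0 by
      rw [RandomDynamics.GlobalField.greenSeq, h.2, zero_div]
    induction n with
    | zero => exact ⟨𝔎.embed_ne_zero v hz, by simp [RandomDynamics.Lift.iter, hv.2]⟩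
    | succ n ih =>
      obtain ⟨h1, h2⟩ := hc (γ n) v _ ih.1
      refine ⟨h1, ?_⟩
      have h3 := h2.trans ((hCle _ v).trans hv.1.le)
      rw [ih.2, mul_zero, sub_zero] at h3
      exact abs_nonpos_iff.1 h3
  have hout' : ∀ v, v ∉ T → 𝔎.green v γ' (𝔎.embed v z) = 0 := fun v hv =>
    tendsto_nhds_unique (hgreen γ v _ (𝔎.embed_ne_zero v hz)).1
      (tendsto_const_nhds.congr fun n => (hout v hv n).symm)
  have hsum : ∀ f : 𝔎.Place → ℝ, (∀ v, v ∉ T → f v = 0) →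
      ∑ᶠ v, (𝔎.localDegree v : ℝ) * f v = ∑ v ∈ hTf.toFinset, (𝔎.localDegree v : ℝ) * f v := by
    intro f hf
    refine finsum_eq_sum_of_support_subset _ fun v hv => ?_
    by_contra h
    rw [Set.Finite.coe_toFinset] at h
    exact hv (by simp [hf v h])
  have hheight : ∀ n, 𝔎.heightSeq (fun i => (γ i : RandomDynamics.Endo K))
      (Projectivization.mk K z hz) n =
      ∑ v ∈ hTf.toFinset, (𝔎.localDegree v : ℝ) * 𝔎.greenSeq v γ' (𝔎.embed v z) n := by
    intro n
    rw [← hsum (fun v => 𝔎.greenSeq v γ' (𝔎.embed v z) n) fun v hv => hout v hv n,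
      RandomDynamics.GlobalField.heightSeq,
      RandomDynamics.Endo.iter_mk _ γ' (fun i => hlift (γ i)) hz,
      RandomDynamics.Endo.iterDegree_eq _ γ' (fun i => hlift (γ i)), 𝔎.weilHeight_mk,
      div_eq_mul_inv, finsum_mul']
    · refine finsum_congr fun v => ?_
      rw [RandomDynamics.GlobalField.greenSeq, mul_assoc, div_eq_mul_inv]
      unfold RandomDynamics.GlobalField.embed
      rw [RandomDynamics.Lift.iter_algebraMap]
    · refine (𝔎.finite_vnorm_embed_ne_one (RandomDynamics.Lift.iter_ne_zero γ' hz n)).subset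
        fun v hv h => hv ?_
      simp [h]
  have hlim : Tendsto (𝔎.heightSeq (fun i => (γ i : RandomDynamics.Endo K))
      (Projectivization.mk K z hz)) atTop
      (𝓝 (∑ v ∈ hTf.toFinset, (𝔎.localDegree v : ℝ) * 𝔎.green v γ' (𝔎.embed v z))) := by
    refine Tendsto.congr (fun n => (hheight n).symm) (tendsto_finsetSum _ fun v _ => ?_)
    exact (hgreen γ v _ (𝔎.embed_ne_zero v hz)).1.const_mul _
  have hcan := hlim.limUnder_eq
  refine ⟨?_, hTf.subset fun v hv => ?_, ?_⟩
  · rw [RandomDynamics.GlobalField.canonicalHeight, hcan]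
    exact hlim
  · by_contra h
    exact hv (by rw [hout' v h, mul_zero])
  · rw [hsum (fun v => 𝔎.green v γ' (𝔎.embed v z)) hout']
    exact hcan
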